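/- All groups are abelian, written additively. Let $\mathsf{HA}$ be the category of Hausdorff topological abelian groups and continuous homomorphisms. A subset $\Sigma$ of such a group $X$ is \emph{precompact} if for every open neighbourhood $U$ of $0$ there are finitely many $x_1,\dots,x_n\in X$ with $\Sigma\subseteq\bigcup_i (x_i+U)$. Let $\mathsf{LPA}\subset\mathsf{HA}$ be the full subcategory of \emph{locally precompact} groups ($0$ has a precompact neighbourhood), and $\mathsf{PGA}\subset\mathsf{LPA}$ the full subcategory of those locally precompact groups which are moreover \emph{precompactly generated} ($0$ has a precompact neighbourhood which generates the group as an abstract group). A sequence $X'\xrightarrow{i}X\xrightarrow{j}X''$ in $\mathsf{LPA}$ is \emph{exact} if it is a short exact sequence of the underlying abelian groups, $i$ is a closed map and $j$ is an open map. In a category with zero morphisms, kernels and cokernels, a morphism $f\colon A\to B$ is \emph{admissible} if the canonical morphism $\operatorname{coker}(\ker f\to A)\to\ker(B\to\operatorname{coker} f)$ is an isomorphism. An additive category is \emph{quasi-abelian} if all kernels and cokernels exist, pushouts of admissible monics along arbitrary morphisms exist and are admissible monics, and pullbacks of admissible epics along arbitrary morphisms exist and are admissible epics. Then: (1) If $X\in\mathsf{LPA}$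 and $A\subseteq X$ is a closed subgroup, then $A$ (with the subspace topology) and $X/A$ (with the quotient topology) lie in $\mathsf{LPA}$. (2) If $X\in\mathsf{PGA}$ and $A\subseteq X$ is a closed subgroup, then $A$ and $X/A$ lie in $\mathsf{PGA}$. (3) $\mathsf{PGA}$ is extension-closed in $\mathsf{LPA}$: if $X'\to X\to X''$ is an exact sequence in $\mathsf{LPA}$ with $X',X''\in\mathsf{PGA}$, then $X\in\mathsf{PGA}$. (4) Let $\mathsf{C}\in\{\mathsf{LPA},\mathsf{PGA}\}$ and let $f\colon X\to Y$ be a morphism in $\mathsf{C}$. (a) The group $\ker f=\{x\in X\mid f(x)=0\}$ with the subspace topology lies in $\mathsf{C}$, and with its inclusion into $X$ it is a kernel of $f$ both in $\mathsf{C}$ and in $\mathsf{HA}$; the inclusion is injective and closed. (b) The group $\operatorname{coker} f=Y/\overline{f(X)}$ with the quotient topology lies in $\mathsf{C}$, and with the projection from $Y$ it is a cokernel of $f$ both in $\mathsf{C}$ and in $\mathsf{HA}$; the projection is surjective and open. (c) $f$ is a monomorphism in $\mathsf{C}$ if and only if it is injective, if and only if $\ker f$ is zero. The closure $\overline{f(X)}$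 with the subspace topology lies in $\mathsf{C}$ and its inclusion into $Y$ is a kernel in $\mathsf{C}$ of $Y\to\operatorname{coker} f$. (d) $f$ is an epimorphism in $\mathsf{C}$ if and only if $f(X)$ is dense in $Y$, if and only if $\operatorname{coker} f$ is zero. The quotient $X/\ker f$ lies in $\mathsf{C}$ and the projection $X\to X/\ker f$ is a cokernel in $\mathsf{C}$ of $\ker f\to X$. (5) The categories $\mathsf{LPA}$ and $\mathsf{PGA}$ are quasi-abelian. -/

import Mathlib

open CategoryTheory CategoryTheory.Limits Topology

universe v u

/-! ### The category of Hausdorff topological abelian groups -/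

/-- A Hausdorff topological abelian group (written additively). -/
structure HA : Type (u + 1) where
  /-- the underlying set -/
  carrier : Type u
  [addCommGroup : AddCommGroup carrier]
  [topologicalSpace : TopologicalSpace carrier]
  [isTopologicalAddGroup : IsTopologicalAddGroup carrier]
  [t2Space : T2Space carrier]

namespace HA

instance : CoeSort HA.{u} (Type u) := ⟨HA.carrier⟩

attribute [instance] HA.addCommGroup HA.topologicalSpace HA.isTopologicalAddGroup HA.t2Space

/-- A morphism of Hausdorff abelian groups is a continuous group homomorphism. -/
@[ext]
structure Hom (X Y : HA.{u}) : Type u where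
  /-- the underlying continuous group homomorphism -/
  toContHom : X →ₜ+ Y

instance : Category HA.{u} where
  Hom X Y := Hom X Y
  id X := ⟨ContinuousAddMonoidHom.id X⟩
  comp f g := ⟨g.toContHom.comp f.toContHom⟩

instance : ConcreteCategory HA.{u} (fun X Y => X →ₜ+ Y) where
  hom f := f.toContHom
  ofHom f := ⟨f⟩

/-- Morphisms of Hausdorff abelian groups are added pointwise. -/
instance (X Y : HA.{u}) : AddCommGroup (X ⟶ Y) :=
  Equiv.addCommGroup
    { toFun := fun f : Hom X Y => f.toContHom
      invFun := fun f => ⟨f⟩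
      left_inv := fun _ => rfl
      right_inv := fun _ => rfl }

instance : Preadditive HA.{u} where
  add_comp X Y Z f f' g := by
    apply Hom.ext
    ext x
    exact map_add g.toContHom (f.toContHom x) (f'.toContHom x)
  comp_add X Y Z f g g' := by
    apply Hom.ext
    ext x
    rfl

/-! ### Concrete subgroups, quotients, kernels and cokernels -/

/-- The subgroup `A` of `X`, with the subspace topology. -/
def sub (X : HA.{u}) (A : AddSubgroup X) : HA.{u} where
  carrier := A

/-- The inclusion `A → X` of a subgroup. -/
def subι (X : HA.{u}) (A : AddSubgroup X) : X.sub A ⟶ X :=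
  ⟨{ A.subtype with continuous_toFun := continuous_subtype_val }⟩

/-- The quotient `X / A` by a closed subgroup `A`, with the quotient topology. -/
def quot (X : HA.{u}) (A : AddSubgroup X) (hA : IsClosed (A : Set X)) : HA.{u} :=
  haveI := hA
  { carrier := X ⧸ A }

/-- The projection `X → X / A` to the quotient by a closed subgroup. -/
def quotπ (X : HA.{u}) (A : AddSubgroup X) (hA : IsClosed (A : Set X)) : X ⟶ X.quot A hA :=
  ⟨{ QuotientAddGroup.mk' A with continuous_toFun := QuotientAddGroup.continuous_mk }⟩

variable {X Y : HA.{u}}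

/-- The subgroup `{x ∈ X | f x = 0}` of `X`. -/
def kerSubgroup (f : X ⟶ Y) : AddSubgroup X := f.toContHom.toAddMonoidHom.ker

/-- The closure of the set-theoretic image `f(X)`, a subgroup of `Y`. -/
def closedRange (f : X ⟶ Y) : AddSubgroup Y :=
  f.toContHom.toAddMonoidHom.range.topologicalClosure

lemma isClosed_kerSubgroup (f : X ⟶ Y) : IsClosed (kerSubgroup f : Set X) :=
  isClosed_singleton.preimage f.toContHom.continuous_toFun

lemma isClosed_closedRange (f : X ⟶ Y) : IsClosed (closedRange f : Set Y) :=
  AddSubgroup.isClosed_topologicalClosure _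

/-- The group `ker f = {x ∈ X | f x = 0}`, with the subspace topology. -/
def ker (f : X ⟶ Y) : HA.{u} := X.sub (kerSubgroup f)

/-- The inclusion `ker f → X`. -/
def kerι (f : X ⟶ Y) : ker f ⟶ X := X.subι (kerSubgroup f)

/-- The group `coker f`, the quotient of `Y` by the closure of `f(X)`. -/
def coker (f : X ⟶ Y) : HA.{u} := Y.quot (closedRange f) (isClosed_closedRange f)

/-- The projection `Y → coker f`. -/
def cokerπ (f : X ⟶ Y) : Y ⟶ coker f := Y.quotπ (closedRange f) (isClosed_closedRange f)

/-- The closure of `f(X)` in `Y`, with the subspace topology. -/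
def im (f : X ⟶ Y) : HA.{u} := Y.sub (closedRange f)

/-- The inclusion of the closure of `f(X)` into `Y`. -/
def imι (f : X ⟶ Y) : im f ⟶ Y := Y.subι (closedRange f)

/-- The quotient group `X / ker f`, with the quotient topology. -/
def coim (f : X ⟶ Y) : HA.{u} := X.quot (kerSubgroup f) (isClosed_kerSubgroup f)

/-- The projection `X → X / ker f`. -/
def coimπ (f : X ⟶ Y) : X ⟶ coim f := X.quotπ (kerSubgroup f) (isClosed_kerSubgroup f)

/-- A sequence `X' → X → X''` is exact if it is a short exact sequence of the underlying abelian
groups, the first map is closed and the second map is open. -/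
structure IsExactSequence {X' X X'' : HA.{u}} (i : X' ⟶ X) (j : X ⟶ X'') : Prop where
  injective : Function.Injective i
  exact : Function.Exact i j
  surjective : Function.Surjective j
  isClosedMap : IsClosedMap i
  isOpenMap : IsOpenMap j

end HA

/-! ### Locally precompact and precompactly generated groups -/

section Precompact

variable {G : Type u} [AddCommGroup G] [TopologicalSpace G]

/-- A subset `S` of a topological abelian group is precompact if for every open neighbourhood `U`
of `0` finitely many translates `x + U` cover `S`. -/
def IsPrecompact (S : Set G) : Prop :=
  ∀ U : Set G, IsOpen U → (0 : G) ∈ U → ∃ F : Finset G, S ⊆ ⋃ x ∈ F, (fun y => x + y) '' U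

variable (G) in
/-- A topological abelian group is locally precompact if `0` has a precompact neighbourhood. -/
def IsLocallyPrecompact : Prop :=
  ∃ U ∈ 𝓝 (0 : G), IsPrecompact U

variable (G) in
/-- `0` has a precompact neighbourhood which generates the group as an abstract group. -/
def IsPrecompactlyGenerated : Prop :=
  ∃ U ∈ 𝓝 (0 : G), IsPrecompact U ∧ AddSubgroup.closure U = ⊤

end Precompact

/-- The property of being a locally precompact Hausdorff abelian group; the category `LPA` is the
full subcategory `LPA.FullSubcategory` of `HA`. -/
def LPA : ObjectProperty HA.{u} := fun X => IsLocallyPrecompact X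

/-- The property of being a locally precompact, precompactly generated Hausdorff abelian group;
the category `PGA` is the full subcategory `PGA.FullSubcategory` of `HA`. -/
def PGA : ObjectProperty HA.{u} := fun X => IsLocallyPrecompact X ∧ IsPrecompactlyGenerated X

/-! ### Kernels, cokernels and quasi-abelian categories -/

section QuasiAbelian

variable {C : Type u} [Category.{v} C] [Preadditive C]

/-- `i` is a kernel of `f` in the sense of category theory. -/
def IsKernelOf {K X Y : C} (i : K ⟶ X) (f : X ⟶ Y) : Prop :=
  ∃ w : i ≫ f = 0, Nonempty (IsLimit (KernelFork.ofι i w))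

/-- `p` is a cokernel of `f` in the sense of category theory. -/
def IsCokernelOf {X Y Q : C} (p : Y ⟶ Q) (f : X ⟶ Y) : Prop :=
  ∃ w : f ≫ p = 0, Nonempty (IsColimit (CokernelCofork.ofπ p w))

/-- A morphism is admissible (or strict) if the canonical morphism from its co-image
`coker (ker f → A)` to its image `ker (B → coker f)` is an isomorphism. -/
def IsAdmissible [HasKernels C] [HasCokernels C] {A B : C} (f : A ⟶ B) : Prop :=
  IsIso (Abelian.coimageImageComparison f)

variable (C) in
/-- A preadditive category is quasi-abelian if it is additive, has all kernels and cokernels,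
pushouts of admissible monics along arbitrary morphisms exist and are admissible monics, and
pullbacks of admissible epics along arbitrary morphisms exist and are admissible epics. -/
structure IsQuasiAbelian : Prop where
  [hasFiniteBiproducts : HasFiniteBiproducts C]
  [hasKernels : HasKernels C]
  [hasCokernels : HasCokernels C]
  hasPushout : ∀ {A B X : C} (f : A ⟶ B) (g : A ⟶ X), Mono f → IsAdmissible f → HasPushout f g
  pushout_admissible_mono : ∀ {A B X P : C} (f : A ⟶ B) (g : A ⟶ X) (g' : B ⟶ P) (f' : X ⟶ P),
    IsPushout f g g' f' → Mono f → IsAdmissible f → Mono f' ∧ IsAdmissible f'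
  hasPullback : ∀ {A B Y : C} (f : A ⟶ B) (g : Y ⟶ B), Epi f → IsAdmissible f → HasPullback f g
  pullback_admissible_epi : ∀ {A B Y P : C} (f : A ⟶ B) (g : Y ⟶ B) (g' : P ⟶ A) (f' : P ⟶ Y),
    IsPullback g' f' f g → Epi f → IsAdmissible f → Epi f' ∧ IsAdmissible f'

end QuasiAbelian

/-- The description of kernel, cokernel, image and co-image of a morphism `f : X ⟶ Y` in the full
subcategory of `HA` given by `P`: the concrete objects of `HA` lie in `P` and have the required
universal property in the subcategory; the kernel and cokernel also have it in `HA`. -/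
structure ComputedAsInHA (P : ObjectProperty HA.{u}) {X Y : P.FullSubcategory} (f : X ⟶ Y) :
    Prop where
  /-- `{x ∈ X | f x = 0}` lies in the subcategory -/
  ker_mem : P (HA.ker f.hom)
  ker_isKernel : IsKernelOf
    (ObjectProperty.homMk (HA.kerι f.hom) : (⟨HA.ker f.hom, ker_mem⟩ : P.FullSubcategory) ⟶ X) f
  ker_isKernel_HA : IsKernelOf (HA.kerι f.hom) f.hom
  kerι_injective : Function.Injective (HA.kerι f.hom)
  kerι_isClosedMap : IsClosedMap (HA.kerι f.hom)
  /-- the quotient of `Y` by the closure of `f(X)` lies in the subcategory -/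
  coker_mem : P (HA.coker f.hom)
  coker_isCokernel : IsCokernelOf
    (ObjectProperty.homMk (HA.cokerπ f.hom) :
      Y ⟶ (⟨HA.coker f.hom, coker_mem⟩ : P.FullSubcategory)) f
  coker_isCokernel_HA : IsCokernelOf (HA.cokerπ f.hom) f.hom
  cokerπ_surjective : Function.Surjective (HA.cokerπ f.hom)
  cokerπ_isOpenMap : IsOpenMap (HA.cokerπ f.hom)
  mono_iff_injective : Mono f ↔ Function.Injective f.hom
  mono_iff_ker_isZero : Mono f ↔ IsZero (⟨HA.ker f.hom, ker_mem⟩ : P.FullSubcategory)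
  /-- the category-theoretic image `ker (Y → coker f)` is the closure of `f(X)` -/
  im_mem : P (HA.im f.hom)
  im_isKernel : IsKernelOf
    (ObjectProperty.homMk (HA.imι f.hom) : (⟨HA.im f.hom, im_mem⟩ : P.FullSubcategory) ⟶ Y)
    (ObjectProperty.homMk (HA.cokerπ f.hom) :
      Y ⟶ (⟨HA.coker f.hom, coker_mem⟩ : P.FullSubcategory))
  epi_iff_denseRange : Epi f ↔ DenseRange f.hom
  epi_iff_coker_isZero : Epi f ↔ IsZero (⟨HA.coker f.hom, coker_mem⟩ : P.FullSubcategory)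
  /-- the category-theoretic co-image `coker (ker f → X)` is `X / ker f` -/
  coim_mem : P (HA.coim f.hom)
  coim_isCokernel : IsCokernelOf
    (ObjectProperty.homMk (HA.coimπ f.hom) :
      X ⟶ (⟨HA.coim f.hom, coim_mem⟩ : P.FullSubcategory))
    (ObjectProperty.homMk (HA.kerι f.hom) : (⟨HA.ker f.hom, ker_mem⟩ : P.FullSubcategory) ⟶ X)

/-! The categorical assertions hold in any full subcategory of `HA` stable under closed subgroups,
quotients by closed subgroups and finite products (`IsStableSubcategory`). There the concrete
kernels and cokernels keep their universal properties, so admissible monics are exactly the closed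
embeddings and admissible epics exactly the open quotient maps. The pushout of a closed embedding
and the pullback of an open quotient map are built from products, subgroups and quotients, and both
classes of maps are preserved.

The stability properties are direct, except that a subgroup of a precompactly generated group is
again precompactly generated. This needs no completion and no structure theory, only coarse
geometry. A symmetric precompact neighbourhood `W` of `0` satisfies `W + W ⊆ F + W` with `F` finite;
sets covered by finitely many translates of `W` play the role of bounded sets. If `W` generates `G`,
then `G` looks like `ℤ^m` up to bounded error (`IsCoarseSubgroup.exists_lattice`): each element is a
lattice combination plus a bounded remainder, and a bounded set contains only finitely many lattice
combinations. The coefficients are therefore quasi-morphisms, hence at bounded distance from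
homomorphisms to `ℝ`. Together these give `Φ : G → ℝ^m` under which preimages of balls are bounded.

For a subgroup `A`, the image `Φ(A)` is generated by its elements in some ball. Hence `A` is
generated by its intersection with the preimage of that ball, which also contains `A ∩ ker Φ`. This
is `IsCoarseSubgroup.exists_covered_le_closure`. -/

/-! ### Coarse geometry of abelian groups: bounded sets and lattices -/

section Coarse

open scoped Pointwise

/-- `S` is covered by finitely many translates of `W`. -/
def CoveredBy {G : Type*} [AddCommGroup G] (W S : Set G) : Prop :=
  ∃ F : Set G, F.Finite ∧ S ⊆ F + W

/-- A symmetric subset containing `0` whose double is covered by finitely many translates of it. -/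
structure IsCoarseSubgroup {G : Type*} [AddCommGroup G] (W : Set G) : Prop where
  zero_mem : 0 ∈ W
  neg_mem : ∀ x ∈ W, -x ∈ W
  add_covered : CoveredBy W (W + W)

namespace CoveredBy

variable {G : Type*} [AddCommGroup G] {W S T : Set G}

lemma mono (h : CoveredBy W T) (hST : S ⊆ T) : CoveredBy W S :=
  let ⟨F, hF, hT⟩ := h
  ⟨F, hF, hST.trans hT⟩

lemma refl (W : Set G) : CoveredBy W W :=
  ⟨{0}, Set.finite_singleton 0, by simp⟩

lemma of_finite (hW : IsCoarseSubgroup W) (hS : S.Finite) : CoveredBy W S :=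
  ⟨S, hS, fun x hx => ⟨x, hx, 0, hW.zero_mem, add_zero x⟩⟩

lemma union (hS : CoveredBy W S) (hT : CoveredBy W T) : CoveredBy W (S ∪ T) := by
  obtain ⟨F, hF, hS⟩ := hS
  obtain ⟨F', hF', hT⟩ := hT
  refine ⟨F ∪ F', hF.union hF', ?_⟩
  rw [Set.union_add]
  exact Set.union_subset_union hS hT

lemma neg (hW : IsCoarseSubgroup W) (hS : CoveredBy W S) : CoveredBy W (-S) := by
  obtain ⟨F, hF, hS⟩ := hS
  refine ⟨-F, hF.neg, fun x hx => ?_⟩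
  obtain ⟨f, hf, w, hw, h⟩ := hS hx
  refine ⟨-f, by simpa using hf, -w, hW.neg_mem w hw, ?_⟩
  simp only at h ⊢
  rw [← neg_add, h, neg_neg]

lemma add (hW : IsCoarseSubgroup W) (hS : CoveredBy W S) (hT : CoveredBy W T) :
    CoveredBy W (S + T) := by
  obtain ⟨F, hF, hS⟩ := hS
  obtain ⟨F', hF', hT⟩ := hT
  obtain ⟨F₀, hF₀, h₀⟩ := hW.add_covered
  refine ⟨F + F' + F₀, (hF.add hF').add hF₀, ?_⟩
  calc S + T ⊆ (F + W) + (F' + W) := Set.add_subset_add hS hT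
    _ = F + F' + (W + W) := by abel
    _ ⊆ F + F' + (F₀ + W) := Set.add_subset_add_left h₀
    _ = F + F' + F₀ + W := by abel

lemma image {H : Type*} [AddCommGroup H] (φ : G →+ H) (h : CoveredBy W S) :
    CoveredBy (φ '' W) (φ '' S) := by
  obtain ⟨F, hF, hS⟩ := h
  refine ⟨φ '' F, hF.image φ, ?_⟩
  rw [← Set.image_add]
  exact Set.image_mono hS

/-- Two multiples of `x` in the same translate of `W` differ by an element of `W + W`, by symmetry.
Choosing one reference multiple in each of the finitely many translates gives the bounded indices
`j`. -/
lemma exists_centers (hW : IsCoarseSubgroup W) (hS : CoveredBy W S) (x : G) :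
    ∃ B : ℤ, ∀ k : ℤ, k • x ∈ S → ∃ j : ℤ, |j| ≤ B ∧ (k - j) • x ∈ W + W := by
  classical
  obtain ⟨F, hF, hS⟩ := hS
  -- The default `0` is never used below: only translates that contain a multiple of `x` occur.
  let c : G → ℤ := fun f => if h : ∃ k : ℤ, k • x - f ∈ W then h.choose else 0
  obtain ⟨B, hB⟩ := (hF.image fun f => |c f|).bddAbove
  refine ⟨B, fun k hk => ?_⟩
  obtain ⟨f, hf, w, hw, h⟩ := hS hk
  simp only at h
  have hex : ∃ k : ℤ, k • x - f ∈ W := ⟨k, by rw [← h]; simpa using hw⟩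
  have hc : c f • x - f ∈ W := by
    simp only [c, dif_pos hex]
    exact hex.choose_spec
  refine ⟨c f, hB ⟨f, hf, rfl⟩, w, hw, _, hW.neg_mem _ hc, ?_⟩
  simp only
  rw [sub_smul, ← h]
  abel

end CoveredBy

namespace IsCoarseSubgroup

variable {G : Type*} [AddCommGroup G] {W : Set G}

lemma image {H : Type*} [AddCommGroup H] (hW : IsCoarseSubgroup W) (φ : G →+ H) :
    IsCoarseSubgroup (φ '' W) where
  zero_mem := ⟨0, hW.zero_mem, map_zero φ⟩
  neg_mem := by
    rintro _ ⟨x, hx, rfl⟩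
    exact ⟨-x, hW.neg_mem x hx, map_neg φ x⟩
  add_covered := by
    rw [← Set.image_add]
    exact hW.add_covered.image φ

lemma neg_mem_add (hW : IsCoarseSubgroup W) {x : G} (hx : x ∈ W + W) : -x ∈ W + W := by
  obtain ⟨a, ha, b, hb, rfl⟩ := hx
  exact ⟨-a, hW.neg_mem a ha, -b, hW.neg_mem b hb, (neg_add a b).symm⟩

/-- A cyclic subgroup meeting a covered set infinitely often is covered. -/
lemma finite_or_covered_zmultiples (hW : IsCoarseSubgroup W) (x : G) :
    (∀ S, CoveredBy W S → {k : ℤ | k • x ∈ S}.Finite) ∨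
      CoveredBy W (AddSubgroup.zmultiples x : Set G) := by
  by_contra! hcon
  obtain ⟨⟨S, hS, hinf⟩, hnot⟩ := hcon
  apply hnot
  -- Infinitely many `k` against boundedly many centres `j` force `|k - j|` to be arbitrarily large;
  -- the symmetry of `W + W` fixes the sign.
  have hlarge : ∀ N : ℤ, ∃ m : ℤ, N < m ∧ m • x ∈ W + W := by
    intro N
    obtain ⟨B, hB⟩ := hS.exists_centers hW x
    obtain ⟨k, hk, hkN⟩ := Set.Infinite.exists_notMem_finset hinf (Finset.Icc (-(N + B)) (N + B))
    obtain ⟨j, hj, hm⟩ := hB k hk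
    rw [Finset.mem_Icc] at hkN
    rw [abs_le] at hj
    by_cases h : N < k - j
    · exact ⟨_, h, hm⟩
    · refine ⟨-(k - j), by omega, ?_⟩
      rw [neg_smul]
      exact hW.neg_mem_add hm
  set V : Set G := (W + W) + (W + W) with hV
  have hVc : CoveredBy W V := hW.add_covered.add hW hW.add_covered
  obtain ⟨B, hB⟩ := hVc.exists_centers hW x
  obtain ⟨m, hmB, hm⟩ := hlarge B
  have hVneg : ∀ y ∈ V, -y ∈ V := by
    rintro _ ⟨a, ha, b, hb, rfl⟩
    exact ⟨-a, hW.neg_mem_add ha, -b, hW.neg_mem_add hb, (neg_add a b).symm⟩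
  -- The multiples of `x` in `V` have bounded gaps: moving by a small `j` brings `k • x` back into
  -- `W + W`, and adding `m • x ∈ W + W` lands in `V`. As `m > B ≥ |j|`, the total step `j + m` is
  -- positive.
  have hstep : ∀ k : ℤ, k • x ∈ V → ∃ l : ℤ, 1 ≤ l ∧ l ≤ m + B ∧ (k + l) • x ∈ V := by
    intro k hk
    obtain ⟨j, hj, h⟩ := hB (-k) (by rw [neg_smul]; exact hVneg _ hk)
    rw [abs_le] at hj
    refine ⟨j + m, by omega, by omega, -((-k - j) • x), hW.neg_mem_add h, m • x, hm, ?_⟩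
    simp only
    rw [← neg_smul, ← add_smul]
    congr 1
    ring
  have h0V : (0 : ℤ) • x ∈ V := by
    have h0 := hW.zero_mem
    exact ⟨0, ⟨0, h0, 0, h0, by simp⟩, 0, ⟨0, h0, 0, h0, by simp⟩, by simp⟩
  have hmB0 : 0 ≤ m + B := by
    obtain ⟨l, h1, h2, -⟩ := hstep 0 h0V
    omega
  have hnat : ∀ n : ℕ, ∃ t : ℤ, n ≤ t ∧ t ≤ n + (m + B) ∧ t • x ∈ V := by
    intro n
    induction n with
    | zero => exact ⟨0, by simp, by simpa using hmB0, h0V⟩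
    | succ n ih =>
      obtain ⟨t, h1, h2, ht⟩ := ih
      by_cases htn : t = n
      · obtain ⟨l, hl1, hl2, hl⟩ := hstep t ht
        exact ⟨t + l, by push_cast; omega, by push_cast; omega, hl⟩
      · exact ⟨t, by push_cast; omega, by push_cast; omega, ht⟩
  -- Every index is within `m + B`, up to sign, of one whose multiple lies in `V`, so the finite set
  -- `E` absorbs the gaps.
  set E : Set G := (fun i : ℤ => i • x) '' Set.Icc (-(m + B)) (m + B) with hE
  have hVE : CoveredBy W (V + E) :=
    hVc.add hW (CoveredBy.of_finite hW ((Set.finite_Icc _ _).image _))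
  refine hVE.mono ?_
  rintro _ ⟨k, rfl⟩
  simp only
  obtain ⟨t, h1, h2, ht⟩ := hnat k.natAbs
  rcases le_total 0 k with hk | hk
  · refine ⟨t • x, ht, (k - t) • x, ⟨k - t, ⟨by omega, by omega⟩, rfl⟩, ?_⟩
    simp only
    rw [← add_smul]
    congr 1
    ring
  · refine ⟨-(t • x), hVneg _ ht, (k + t) • x, ⟨k + t, ⟨by omega, by omega⟩, rfl⟩, ?_⟩
    simp only
    rw [← neg_smul, ← add_smul]
    congr 1
    ring

end IsCoarseSubgroup

/-- If finitely many elements generate `G` up to a covered set, these elements may be chosen to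
generate a lattice, every covered set containing only finitely many of their combinations. -/
lemma IsCoarseSubgroup.exists_lattice_of_fin : ∀ (n : ℕ) {G : Type u} [AddCommGroup G]
    {W : Set G} (_ : IsCoarseSubgroup W) (x : Fin n → G) (S : Set G) (_ : CoveredBy W S)
    (_ : ∀ g, ∃ z : Fin n → ℤ, g - ∑ i, z i • x i ∈ S),
    ∃ (m : ℕ) (y : Fin m → G) (S' : Set G), CoveredBy W S' ∧
      (∀ g, ∃ z : Fin m → ℤ, g - ∑ i, z i • y i ∈ S') ∧
      ∀ T, CoveredBy W T → {z : Fin m → ℤ | ∑ i, z i • y i ∈ T}.Finite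
  | 0, _, _, _, _, x, S, hS, hx => ⟨0, x, S, hS, hx, fun _ _ => Set.toFinite _⟩
  | n + 1, G, _, W, hW, x, S, hS, hx => by
    rcases hW.finite_or_covered_zmultiples (x 0) with hfin | hcov
    -- Here `x 0` is a genuine lattice direction: divide by it, find a lattice in the quotient, lift
    -- that lattice and adjoin `x 0`.
    · let π := QuotientAddGroup.mk' (AddSubgroup.zmultiples (x 0))
      have hπ : Function.Surjective π := QuotientAddGroup.mk'_surjective _
      have hπ0 : π (x 0) = 0 :=
        (QuotientAddGroup.eq_zero_iff _).2 (AddSubgroup.mem_zmultiples _)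
      obtain ⟨m, y, S', hS', hy, hT⟩ := exists_lattice_of_fin n (hW.image π)
        (fun i => π (x i.succ)) (π '' S) (hS.image π) (by
          intro g
          obtain ⟨g, rfl⟩ := hπ g
          obtain ⟨z, hz⟩ := hx g
          refine ⟨fun i => z i.succ, _, hz, ?_⟩
          rw [Fin.sum_univ_succ, map_sub, map_add, map_zsmul, hπ0, map_sum]
          simp)
      choose y' hy' using fun i => hπ (y i)
      obtain ⟨F, hF, hS'⟩ := hS'
      -- Lifting the centres alone gives a covered set `F' + W` whose image contains the remainders
      -- found in the quotient; what is left over is a multiple of `x 0`.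
      obtain ⟨F', hF', rfl⟩ : ∃ F' : Set G, F'.Finite ∧ π '' F' = F := by
        obtain ⟨s, hs⟩ := hπ.hasRightInverse
        exact ⟨s '' F, hF.image s, by rw [← Set.image_comp, hs.comp_eq_id, Set.image_id]⟩
      refine ⟨m + 1, Fin.cons (x 0) y', F' + W, ⟨F', hF', subset_rfl⟩, fun g => ?_, fun T hTc => ?_⟩
      · obtain ⟨z, hz⟩ := hy (π g)
        obtain ⟨_, ⟨f, hf, rfl⟩, _, ⟨w, hw, rfl⟩, h⟩ := hS' hz
        have h' : π (g - ∑ i, z i • y' i - (f + w)) = 0 := by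
          simp only at h
          rw [map_sub, map_sub, map_add, h, map_sum]
          simp [hy']
        obtain ⟨k, hk⟩ := (QuotientAddGroup.eq_zero_iff _).1 h'
        refine ⟨Fin.cons k z, f, hf, w, hw, ?_⟩
        simp only at hk
        simp only [Fin.sum_univ_succ, Fin.cons_zero, Fin.cons_succ]
        rw [hk]
        abel
      · have h1 := hT _ (hTc.image π)
        -- Finitely many tails `z` by the statement in the quotient, and for each of them finitely
        -- many coefficients of `x 0` by `hfin`.
        refine Set.Finite.subset (Set.Finite.biUnion h1 (t := fun z =>
          (fun k : ℤ => (Fin.cons k z : Fin (m + 1) → ℤ)) ''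
            {k : ℤ | k • x 0 ∈ T + {-∑ i, z i • y' i}}) fun z _ => ?_) ?_
        · exact (hfin _ (hTc.add hW (CoveredBy.of_finite hW (Set.finite_singleton _)))).image _
        · intro z hz
          simp only [Set.mem_ofPred_eq, Fin.sum_univ_succ, Fin.cons_zero, Fin.cons_succ] at hz
          simp only [Set.mem_iUnion]
          refine ⟨fun i => z i.succ, ⟨_, hz, ?_⟩, z 0, ⟨_, hz, _, rfl, ?_⟩, ?_⟩
          · rw [map_add, map_zsmul, hπ0, map_sum]
            simp [hy']
          · simp
          · exact Fin.cons_self_tail z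
    -- Here the cyclic group generated by `x 0` is bounded, so it is absorbed into the remainder set
    -- and the generator is dropped.
    · refine exists_lattice_of_fin n hW (fun i => x i.succ) _ (hS.add hW hcov) fun g => ?_
      obtain ⟨z, hz⟩ := hx g
      refine ⟨fun i => z i.succ, _, hz, z 0 • x 0, ⟨z 0, rfl⟩, ?_⟩
      simp only
      rw [Fin.sum_univ_succ]
      abel

/-- Since `W + W ⊆ F + W`, each sum of two remainders in `W` can be traded for one element of `F`
and one remainder in `W`. So the finitely many elements of `F` generate `G` up to `W`, and the
reduction to a lattice applies to them. -/
lemma IsCoarseSubgroup.exists_lattice {G : Type u} [AddCommGroup G] {W : Set G}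
    (hW : IsCoarseSubgroup W) (hgen : AddSubgroup.closure W = ⊤) :
    ∃ (m : ℕ) (y : Fin m → G) (S' : Set G), CoveredBy W S' ∧
      (∀ g, ∃ z : Fin m → ℤ, g - ∑ i, z i • y i ∈ S') ∧
      ∀ T, CoveredBy W T → {z : Fin m → ℤ | ∑ i, z i • y i ∈ T}.Finite := by
  obtain ⟨F, hF, hWF⟩ := hW.add_covered
  obtain ⟨n, f, -, rfl⟩ := hF.fin_param
  refine IsCoarseSubgroup.exists_lattice_of_fin n hW f W (.refl W) fun g => ?_
  have hg : g ∈ AddSubgroup.closure W := hgen ▸ AddSubgroup.mem_top g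
  induction hg using AddSubgroup.closure_induction with
  | mem x hx => exact ⟨0, by simpa using hx⟩
  | zero => exact ⟨0, by simpa using hW.zero_mem⟩
  | add a b _ _ ha hb =>
    obtain ⟨z, hz⟩ := ha
    obtain ⟨z', hz'⟩ := hb
    obtain ⟨_, ⟨j, rfl⟩, w, hw, h⟩ := hWF ⟨_, hz, _, hz', rfl⟩
    refine ⟨z + z' + Pi.single j 1, ?_⟩
    have h1 : ∑ i, (Pi.single j 1 : Fin n → ℤ) i • f i = f j := by
      simp [Pi.single_apply, ite_smul]
    simp only [Pi.add_apply, add_smul, Finset.sum_add_distrib, h1]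
    convert hw using 1
    simp only at h
    rw [eq_comm, ← sub_eq_iff_eq_add'] at h
    rw [← h]
    abel
  | neg a _ ha =>
    obtain ⟨z, hz⟩ := ha
    refine ⟨-z, ?_⟩
    convert hW.neg_mem _ hz using 1
    simp [sub_eq_add_neg, add_comm]

/-! ### Linearisation: quasi-morphisms and subgroups of real vector spaces -/

/-- A quasi-morphism from an abelian group to `ℝ` is at bounded distance from a homomorphism. -/
lemma exists_addMonoidHom_near_quasimorphism {G : Type*} [AddCommGroup G] (q : G → ℝ) (C : ℝ)
    (hq : ∀ a b, |q (a + b) - q a - q b| ≤ C) : ∃ φ : G →+ ℝ, ∀ a, |φ a - q a| ≤ C := by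
  -- Homogenisation: the defect bound makes this sequence Cauchy with geometric rate, and after
  -- division by `2 ^ k` the defect of additivity tends to `0`.
  let u : G → ℕ → ℝ := fun a k => q (2 ^ k • a) / 2 ^ k
  have hu : ∀ a k, dist (u a k) (u a (k + 1)) ≤ C / 2 / 2 ^ k := by
    intro a k
    have h := hq (2 ^ k • a) (2 ^ k • a)
    have h2 : (2 ^ (k + 1) : ℕ) • a = 2 ^ k • a + 2 ^ k • a := by
      rw [← add_smul]; congr 1; ring
    have hp : (0 : ℝ) < 2 ^ k := by positivity
    rw [Real.dist_eq, abs_sub_comm]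
    simp only [u, h2]
    rw [show q (2 ^ k • a + 2 ^ k • a) / 2 ^ (k + 1) - q (2 ^ k • a) / 2 ^ k =
      (q (2 ^ k • a + 2 ^ k • a) - q (2 ^ k • a) - q (2 ^ k • a)) / 2 / 2 ^ k by
        field_simp; ring]
    rw [abs_div, abs_div, abs_of_pos hp, abs_of_pos (zero_lt_two' ℝ)]
    gcongr
  choose φ hφ using fun a => cauchySeq_tendsto_of_complete (cauchySeq_of_le_geometric_two (hu a))
  refine ⟨AddMonoidHom.mk' φ fun a b => ?_, fun a => ?_⟩
  · have h1 : Filter.Tendsto (fun k => u (a + b) k - u a k - u b k) Filter.atTop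
        (nhds (φ (a + b) - φ a - φ b)) := ((hφ (a + b)).sub (hφ a)).sub (hφ b)
    have h2 : Filter.Tendsto (fun k => u (a + b) k - u a k - u b k) Filter.atTop (nhds 0) := by
      refine squeeze_zero_norm (a := fun k : ℕ => C / 2 ^ k) (fun k => ?_) ?_
      · have hp : (0 : ℝ) < 2 ^ k := by positivity
        simp only [u, smul_add]
        rw [← sub_div, ← sub_div, Real.norm_eq_abs, abs_div, abs_of_pos hp]
        gcongr
        exact hq _ _
      · exact tendsto_const_nhds.div_atTop (tendsto_pow_atTop_atTop_of_one_lt one_lt_two)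
    have := tendsto_nhds_unique h1 h2
    linarith
  · have := dist_le_of_le_geometric_two_of_tendsto₀ (hu a) (hφ a)
    rw [dist_comm, Real.dist_eq] at this
    simpa [u] using this

/-- Every subgroup of a finite-dimensional real normed space is generated by a bounded subset. -/
lemma AddSubgroup.exists_le_closure_inter_closedBall {E : Type*} [NormedAddCommGroup E]
    [NormedSpace ℝ E] [FiniteDimensional ℝ E] (A : AddSubgroup E) :
    ∃ R : ℝ, 0 ≤ R ∧ A ≤ AddSubgroup.closure (A ∩ Metric.closedBall 0 R) := by
  obtain ⟨s, hsA, hs⟩ := Submodule.fg_span_iff_fg_span_finset_subset (A : Set E) |>.1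
    (IsNoetherian.noetherian (Submodule.span ℝ (A : Set E)))
  have hR : 0 ≤ ∑ i ∈ s, ‖i‖ := Finset.sum_nonneg fun i _ => norm_nonneg i
  -- This radius bounds both the members of the finite spanning set `s ⊆ A` and every combination of
  -- them with coefficients in `[0, 1)`. An element of `A` is an integral combination of `s` plus
  -- such a fractional one, which then lies in `A` too.
  refine ⟨∑ i ∈ s, ‖i‖, hR, fun a ha => ?_⟩
  have has : a ∈ Submodule.span ℝ (s : Set E) := hs ▸ Submodule.subset_span ha
  obtain ⟨c, -, rfl⟩ := Submodule.mem_span_finset.1 has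
  have hfl : ∑ i ∈ s, ⌊c i⌋ • i ∈ A := sum_mem fun i hi => A.zsmul_mem (hsA hi) _
  have hsplit : ∑ i ∈ s, c i • i = ∑ i ∈ s, ⌊c i⌋ • i + ∑ i ∈ s, Int.fract (c i) • i := by
    rw [← Finset.sum_add_distrib]
    refine Finset.sum_congr rfl fun i _ => ?_
    rw [← Int.cast_smul_eq_zsmul ℝ, ← add_smul, Int.floor_add_fract]
  rw [hsplit] at ha ⊢
  refine add_mem (sum_mem fun i hi => zsmul_mem (AddSubgroup.subset_closure (Set.mem_inter ?_ ?_)) _)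
    (AddSubgroup.subset_closure ⟨(add_mem_cancel_left hfl).1 ha, ?_⟩)
  · exact hsA hi
  · rw [mem_closedBall_zero_iff]
    exact Finset.single_le_sum (f := fun i => ‖i‖) (fun i _ => norm_nonneg i) hi
  · rw [mem_closedBall_zero_iff]
    refine norm_sum_le_of_le _ fun i _ => ?_
    rw [norm_smul, Real.norm_eq_abs, Int.abs_fract]
    exact mul_le_of_le_one_left (norm_nonneg i) (Int.fract_lt_one _).le

/-- If a coarse subgroup generates `G`, each subgroup of `G` is generated by a covered set. -/
theorem IsCoarseSubgroup.exists_covered_le_closure {G : Type u} [AddCommGroup G] {W : Set G}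
    (hW : IsCoarseSubgroup W) (hgen : AddSubgroup.closure W = ⊤) (A : AddSubgroup G) :
    ∃ T, CoveredBy W T ∧ A ≤ AddSubgroup.closure (A ∩ T) := by
  obtain ⟨m, y, S, hS, hq, hfin⟩ := hW.exists_lattice hgen
  choose q hq using hq
  -- The defect `q (a + b) - q a - q b` is the coefficient vector of a lattice point in `S + S - S`;
  -- this set is bounded, so only finitely many defects occur.
  have hD : CoveredBy W (S + S + -S) := (hS.add hW hS).add hW (hS.neg hW)
  obtain ⟨C, hC⟩ := ((hfin _ hD).image fun z => ‖z‖).bddAbove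
  have hqC : ∀ i a b, |(q (a + b) i : ℝ) - q a i - q b i| ≤ C := by
    intro i a b
    have hz : ‖q (a + b) - q a - q b‖ ≤ C := by
      refine hC ⟨q (a + b) - q a - q b, ?_, rfl⟩
      refine ⟨_, ⟨_, hq a, _, hq b, rfl⟩, -(a + b - ∑ i, q (a + b) i • y i), ?_, ?_⟩
      · simpa using hq (a + b)
      · simp only [Pi.sub_apply, sub_smul, Finset.sum_sub_distrib]
        abel
    have := (norm_le_pi_norm (q (a + b) - q a - q b) i).trans hz
    rw [Int.norm_eq_abs] at this
    simpa using this
  choose φ hφ using fun i =>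
    exists_addMonoidHom_near_quasimorphism (fun a => (q a i : ℝ)) C (hqC i)
  let Φ : G →+ (Fin m → ℝ) := AddMonoidHom.pi φ
  obtain ⟨R, hR, hA⟩ := (A.map Φ).exists_le_closure_inter_closedBall
  refine ⟨Φ ⁻¹' Metric.closedBall 0 R, ?_, fun a ha => ?_⟩
  -- If `Φ a` is bounded by `R`, then `q a` is bounded by `R + |C|`, so `a` lies in `S` plus one of
  -- finitely many lattice points. The absolute value makes nonnegativity of the radius immediate.
  · have hfin' : (Metric.closedBall (0 : Fin m → ℤ) (R + |C|)).Finite :=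
      (isCompact_closedBall _ _).finite_of_discrete
    refine (hS.add hW (CoveredBy.of_finite hW
      (hfin'.image fun z => ∑ i, z i • y i))).mono fun a ha => ?_
    refine ⟨_, hq a, _, ⟨q a, ?_, rfl⟩, by simp⟩
    rw [Set.mem_preimage, mem_closedBall_zero_iff] at ha
    rw [mem_closedBall_zero_iff]
    refine (pi_norm_le_iff_of_nonneg (by positivity)).2 fun i => ?_
    have h1 : |φ i a| ≤ R := (norm_le_pi_norm (Φ a) i).trans ha
    have h2 := (hφ i a).trans (le_abs_self C)
    rw [Int.norm_eq_abs]
    rw [abs_le] at h1 h2 ⊢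
    constructor <;> linarith
  · have himg : ((A.map Φ : AddSubgroup _) : Set (Fin m → ℝ)) ∩ Metric.closedBall 0 R =
        Φ '' (A ∩ Φ ⁻¹' Metric.closedBall 0 R) := by
      rw [Set.image_inter_preimage, AddSubgroup.coe_map]
    have h := hA (AddSubgroup.mem_map_of_mem Φ ha)
    rw [himg, ← AddMonoidHom.map_closure] at h
    obtain ⟨a', ha', h⟩ := h
    have ha'A : a' ∈ A := (AddSubgroup.closure_le A).2 Set.inter_subset_left ha'
    -- The difference `a - a'` lies in `A ∩ ker Φ`, which is part of the generating set because the
    -- ball contains `0`.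
    rw [← sub_add_cancel a a']
    refine add_mem (AddSubgroup.subset_closure ⟨sub_mem ha ha'A, ?_⟩) ha'
    rw [Set.mem_preimage, map_sub, h, sub_self]
    exact Metric.mem_closedBall_self hR

end Coarse

/-! ### Precompact sets and permanence of local precompactness and precompact generation -/

section Topology

open scoped Pointwise

variable {G H : Type u} [AddCommGroup G] [TopologicalSpace G] [AddCommGroup H] [TopologicalSpace H]
  {S T : Set G}

lemma isPrecompact_iff : IsPrecompact S ↔ ∀ U ∈ 𝓝 (0 : G), CoveredBy U S := by
  have key : ∀ (F U : Set G), ⋃ x ∈ F, (fun y => x + y) '' U = F + U :=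
    fun F U => Set.iUnion_image_left (· + ·)
  constructor
  · intro h U hU
    obtain ⟨F, hF⟩ := h (interior U) isOpen_interior (mem_interior_iff_mem_nhds.2 hU)
    refine ⟨F, F.finite_toSet, hF.trans ?_⟩
    exact (key F (interior U)).subset.trans (Set.add_subset_add_left interior_subset)
  · intro h U hU h0
    obtain ⟨F, hF, hS⟩ := h U (hU.mem_nhds h0)
    lift F to Finset G using hF
    exact ⟨F, hS.trans (key F U).superset⟩

namespace IsPrecompact

lemma mono (hT : IsPrecompact T) (h : S ⊆ T) : IsPrecompact S :=
  isPrecompact_iff.2 fun U hU => (isPrecompact_iff.1 hT U hU).mono h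

lemma union (hS : IsPrecompact S) (hT : IsPrecompact T) : IsPrecompact (S ∪ T) :=
  isPrecompact_iff.2 fun U hU =>
    (isPrecompact_iff.1 hS U hU).union (isPrecompact_iff.1 hT U hU)

lemma of_finite (hS : S.Finite) : IsPrecompact S :=
  isPrecompact_iff.2 fun _ hU =>
    ⟨S, hS, fun x hx => ⟨x, hx, 0, mem_of_mem_nhds hU, add_zero x⟩⟩

lemma image (hS : IsPrecompact S) (f : G →+ H) (hf : Continuous f) : IsPrecompact (f '' S) := by
  refine isPrecompact_iff.2 fun U hU => ?_
  have hV : f ⁻¹' U ∈ 𝓝 0 := hf.continuousAt (by rwa [map_zero])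
  obtain ⟨F, hF, h⟩ := (isPrecompact_iff.1 hS _ hV).image f
  exact ⟨F, hF, h.trans (Set.add_subset_add_left (Set.image_preimage_subset f U))⟩

lemma neg [IsTopologicalAddGroup G] (hS : IsPrecompact S) : IsPrecompact (-S) := by
  simpa using hS.image (negAddMonoidHom : G →+ G) continuous_neg

lemma add [IsTopologicalAddGroup G] (hS : IsPrecompact S) (hT : IsPrecompact T) :
    IsPrecompact (S + T) := by
  refine isPrecompact_iff.2 fun U hU => ?_
  obtain ⟨V, hVo, hV0, hV⟩ := exists_open_nhds_zero_add_subset hU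
  obtain ⟨F, hF, hS⟩ := isPrecompact_iff.1 hS V (hVo.mem_nhds hV0)
  obtain ⟨F', hF', hT⟩ := isPrecompact_iff.1 hT V (hVo.mem_nhds hV0)
  refine ⟨F + F', hF.add hF', ?_⟩
  calc S + T ⊆ (F + V) + (F' + V) := Set.add_subset_add hS hT
    _ = F + F' + (V + V) := by abel
    _ ⊆ F + F' + U := Set.add_subset_add_left hV

lemma of_coveredBy [IsTopologicalAddGroup G] (hT : IsPrecompact T) (h : CoveredBy T S) :
    IsPrecompact S :=
  let ⟨_, hF, hS⟩ := h
  ((of_finite hF).add hT).mono hS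

/-- The centres of a covering in `G` need not come from `H`. Replacing each useful centre `x` by
some `y` with `f y - x ∈ V` costs only a passage from `V` to `V - V`. -/
lemma preimage [IsTopologicalAddGroup G] (hS : IsPrecompact S) (f : H →+ G) (hf : IsInducing f) :
    IsPrecompact (f ⁻¹' S) := by
  classical
  refine isPrecompact_iff.2 fun U hU => ?_
  rw [hf.nhds_eq_comap, map_zero] at hU
  obtain ⟨U', hU', hUU'⟩ := hU
  obtain ⟨V, hV, hVV⟩ := exists_nhds_half_neg hU'
  obtain ⟨F, hF, hSF⟩ := isPrecompact_iff.1 hS V hV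
  let c : G → H := fun x => if h : ∃ y, f y - x ∈ V then h.choose else 0
  refine ⟨c '' F, hF.image c, fun y hy => ?_⟩
  obtain ⟨x, hx, v, hv, h⟩ := hSF hy
  simp only at h
  have hex : ∃ y, f y - x ∈ V := ⟨y, by rw [← h]; simpa using hv⟩
  have hc : f (c x) - x ∈ V := by
    simp only [c, dif_pos hex]
    exact hex.choose_spec
  refine ⟨c x, ⟨x, hx, rfl⟩, y - c x, hUU' ?_, by simp⟩
  have := hVV v hv _ hc
  rw [Set.mem_preimage, map_sub, ← h]
  convert this using 1
  abel

lemma prod {S' : Set H} (hS : IsPrecompact S) (hS' : IsPrecompact S') :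
    IsPrecompact (S ×ˢ S') := by
  refine isPrecompact_iff.2 fun U hU => ?_
  rw [Prod.zero_eq_mk, nhds_prod_eq, Filter.mem_prod_iff] at hU
  obtain ⟨V, hV, V', hV', hVU⟩ := hU
  obtain ⟨F, hF, hS⟩ := isPrecompact_iff.1 hS V hV
  obtain ⟨F', hF', hS'⟩ := isPrecompact_iff.1 hS' V' hV'
  refine ⟨F ×ˢ F', hF.prod hF', ?_⟩
  rintro ⟨x, y⟩ ⟨hx, hy⟩
  obtain ⟨f, hf, v, hv, rfl⟩ := hS hx
  obtain ⟨f', hf', v', hv', rfl⟩ := hS' hy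
  exact ⟨(f, f'), ⟨hf, hf'⟩, (v, v'), hVU ⟨hv, hv'⟩, rfl⟩

end IsPrecompact

lemma IsLocallyPrecompact.of_isInducing [IsTopologicalAddGroup G] (hG : IsLocallyPrecompact G)
    (f : H →+ G) (hf : IsInducing f) : IsLocallyPrecompact H := by
  obtain ⟨U, hU, hUc⟩ := hG
  exact ⟨f ⁻¹' U, hf.continuous.continuousAt (by rwa [map_zero]), hUc.preimage f hf⟩

lemma IsLocallyPrecompact.of_isOpenMap (hG : IsLocallyPrecompact G) (f : G →+ H)
    (hf : Continuous f) (hfo : IsOpenMap f) : IsLocallyPrecompact H := by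
  obtain ⟨U, hU, hUc⟩ := hG
  exact ⟨f '' U, map_zero f ▸ hfo.image_mem_nhds hU, hUc.image f hf⟩

lemma IsLocallyPrecompact.prod (hG : IsLocallyPrecompact G) (hH : IsLocallyPrecompact H) :
    IsLocallyPrecompact (G × H) := by
  obtain ⟨U, hU, hUc⟩ := hG
  obtain ⟨V, hV, hVc⟩ := hH
  exact ⟨U ×ˢ V, prod_mem_nhds hU hV, hUc.prod hVc⟩

lemma IsPrecompactlyGenerated.isLocallyPrecompact (hG : IsPrecompactlyGenerated G) :
    IsLocallyPrecompact G :=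
  let ⟨U, hU, hUc, _⟩ := hG
  ⟨U, hU, hUc⟩

lemma IsPrecompactlyGenerated.of_isOpenMap (hG : IsPrecompactlyGenerated G) (f : G →+ H)
    (hf : Continuous f) (hfo : IsOpenMap f) (hfs : Function.Surjective f) :
    IsPrecompactlyGenerated H := by
  obtain ⟨U, hU, hUc, hgen⟩ := hG
  refine ⟨f '' U, map_zero f ▸ hfo.image_mem_nhds hU, hUc.image f hf, ?_⟩
  rw [← AddMonoidHom.map_closure, hgen, ← AddMonoidHom.range_eq_map,
    AddMonoidHom.range_eq_top.2 hfs]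

lemma IsPrecompactlyGenerated.prod (hG : IsPrecompactlyGenerated G)
    (hH : IsPrecompactlyGenerated H) : IsPrecompactlyGenerated (G × H) := by
  obtain ⟨U, hU, hUc, hUgen⟩ := hG
  obtain ⟨V, hV, hVc, hVgen⟩ := hH
  refine ⟨U ×ˢ V, prod_mem_nhds hU hV, hUc.prod hVc, eq_top_iff.2 ?_⟩
  have h1 : (AddSubgroup.closure U).map (AddMonoidHom.inl G H) ≤ AddSubgroup.closure (U ×ˢ V) := by
    rw [AddMonoidHom.map_closure, AddSubgroup.closure_le]
    rintro _ ⟨x, hx, rfl⟩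
    exact AddSubgroup.subset_closure ⟨hx, mem_of_mem_nhds hV⟩
  have h2 : (AddSubgroup.closure V).map (AddMonoidHom.inr G H) ≤ AddSubgroup.closure (U ×ˢ V) := by
    rw [AddMonoidHom.map_closure, AddSubgroup.closure_le]
    rintro _ ⟨x, hx, rfl⟩
    exact AddSubgroup.subset_closure ⟨mem_of_mem_nhds hU, hx⟩
  rintro ⟨x, y⟩ -
  rw [hUgen] at h1
  rw [hVgen] at h2
  have := add_mem (h1 ⟨x, trivial, rfl⟩) (h2 ⟨y, trivial, rfl⟩)
  simpa using this

/-- A symmetric precompact neighbourhood of `0` is a coarse subgroup. -/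
lemma IsPrecompact.isCoarseSubgroup [IsTopologicalAddGroup G] (hS : IsPrecompact S)
    (hS0 : S ∈ 𝓝 0) (hneg : ∀ x ∈ S, -x ∈ S) : IsCoarseSubgroup S where
  zero_mem := mem_of_mem_nhds hS0
  neg_mem := hneg
  add_covered := isPrecompact_iff.1 (hS.add hS) S hS0

/-- Subgroups of precompactly generated groups are precompactly generated. -/
theorem IsPrecompactlyGenerated.addSubgroup [IsTopologicalAddGroup G]
    (hG : IsPrecompactlyGenerated G) (A : AddSubgroup G) : IsPrecompactlyGenerated A := by
  obtain ⟨U, hU, hUc, hgen⟩ := hG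
  have hW0 : U ∪ -U ∈ 𝓝 (0 : G) := Filter.mem_of_superset hU Set.subset_union_left
  have hWc : IsPrecompact (U ∪ -U) := hUc.union hUc.neg
  have hW : IsCoarseSubgroup (U ∪ -U) := hWc.isCoarseSubgroup hW0 fun x hx => by
    simpa [or_comm] using hx
  obtain ⟨T, hT, hA⟩ := hW.exists_covered_le_closure
    (eq_top_iff.2 (hgen ▸ AddSubgroup.closure_mono Set.subset_union_left)) A
  -- `T` supplies the generators of `A`, while `U` makes the set a neighbourhood of `0`.
  refine ⟨A.subtype ⁻¹' (T ∪ U), ?_, ((hWc.of_coveredBy hT).union hUc).preimage _ .subtypeVal, ?_⟩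
  · exact continuous_subtype_val.continuousAt
      (Filter.mem_of_superset hU Set.subset_union_right)
  · refine AddSubgroup.map_injective A.subtype_injective ?_
    rw [AddMonoidHom.map_closure, ← AddMonoidHom.range_eq_map, AddSubgroup.range_subtype]
    refine le_antisymm ((AddSubgroup.closure_le A).2 ?_)
      (hA.trans (AddSubgroup.closure_mono ?_))
    · rintro _ ⟨x, -, rfl⟩
      exact x.2
    · rintro x ⟨hxA, hxT⟩
      exact ⟨⟨x, hxA⟩, Or.inl hxT, rfl⟩

/-- An extension of precompactly generated groups is precompactly generated if it is locally
precompact. -/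
theorem IsPrecompactlyGenerated.of_extension {G' G'' : Type u} [AddCommGroup G']
    [TopologicalSpace G'] [AddCommGroup G''] [TopologicalSpace G'']
    (hG' : IsPrecompactlyGenerated G') (hG : IsLocallyPrecompact G)
    (hG'' : IsPrecompactlyGenerated G'') (i : G' →+ G) (hi : Continuous i) (j : G →+ G'')
    (hj : IsOpenMap j) (hjs : Function.Surjective j) (hij : Function.Exact i j) :
    IsPrecompactlyGenerated G := by
  obtain ⟨U', -, hU'c, hU'gen⟩ := hG'
  obtain ⟨U, hU, hUc⟩ := hG
  obtain ⟨U'', -, hU''c, hU''gen⟩ := hG''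
  -- As `j` is open, finitely many translates of `j '' U` cover `U''`. Lifts of the centres together
  -- with `U` thus generate a subgroup mapping onto `G''`, and `i '' U'` supplies the kernel of `j`.
  obtain ⟨F, hF, hFU⟩ := isPrecompact_iff.1 hU''c (j '' U) (map_zero j ▸ hj.image_mem_nhds hU)
  obtain ⟨s, hs⟩ := hjs.hasRightInverse
  refine ⟨i '' U' ∪ (s '' F ∪ U), Filter.mem_of_superset hU fun x hx => Or.inr (Or.inr hx),
    (hU'c.image i hi).union ((IsPrecompact.of_finite (hF.image s)).union hUc), ?_⟩
  set K := AddSubgroup.closure (i '' U' ∪ (s '' F ∪ U)) with hK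
  have h1 : i.range ≤ K := by
    rw [AddMonoidHom.range_eq_map, ← hU'gen, AddMonoidHom.map_closure]
    exact AddSubgroup.closure_mono Set.subset_union_left
  have h2 : K.map j = ⊤ := by
    rw [eq_top_iff, ← hU''gen, AddSubgroup.closure_le]
    intro y hy
    obtain ⟨f, hf, _, ⟨x, hx, rfl⟩, rfl⟩ := hFU hy
    refine ⟨s f + x, add_mem (AddSubgroup.subset_closure (Or.inr (Or.inl ⟨f, hf, rfl⟩)))
      (AddSubgroup.subset_closure (Or.inr (Or.inr hx))), ?_⟩
    rw [map_add, hs f]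
  refine eq_top_iff.2 fun x _ => ?_
  obtain ⟨k, hk, hkx⟩ : j x ∈ K.map j := h2 ▸ trivial
  obtain ⟨y, hy⟩ := (hij (x - k)).1 (by rw [map_sub, hkx, sub_self])
  rw [← sub_add_cancel x k, ← hy]
  exact add_mem (h1 ⟨y, rfl⟩) hk

end Topology

/-! ### Kernels, cokernels and admissible morphisms in preadditive categories -/

section Preadditive

variable {C : Type u} [Category.{v} C] [Preadditive C]

lemma isKernelOf_iff {K X Y : C} {i : K ⟶ X} {f : X ⟶ Y} :
    IsKernelOf i f ↔ i ≫ f = 0 ∧ ∀ {Z : C} (t : Z ⟶ X), t ≫ f = 0 → ∃! l : Z ⟶ K, l ≫ i = t := by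
  constructor
  · rintro ⟨w, ⟨h⟩⟩
    exact ⟨w, fun t ht => Fork.IsLimit.existsUnique h t (by rw [ht, comp_zero])⟩
  · rintro ⟨w, h⟩
    exact ⟨w, ⟨KernelFork.IsLimit.ofι i w (fun t ht => (h t ht).choose)
      (fun t ht => (h t ht).choose_spec.1) (fun t ht m hm => (h t ht).choose_spec.2 m hm)⟩⟩

lemma isCokernelOf_iff {X Y Q : C} {p : Y ⟶ Q} {f : X ⟶ Y} :
    IsCokernelOf p f ↔
      f ≫ p = 0 ∧ ∀ {Z : C} (t : Y ⟶ Z), f ≫ t = 0 → ∃! l : Q ⟶ Z, p ≫ l = t := by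
  constructor
  · rintro ⟨w, ⟨h⟩⟩
    exact ⟨w, fun t ht => Cofork.IsColimit.existsUnique h t (by rw [ht, zero_comp])⟩
  · rintro ⟨w, h⟩
    exact ⟨w, ⟨CokernelCofork.IsColimit.ofπ p w (fun t ht => (h t ht).choose)
      (fun t ht => (h t ht).choose_spec.1) (fun t ht m hm => (h t ht).choose_spec.2 m hm)⟩⟩

lemma isKernelOf_kernelι {X Y : C} (f : X ⟶ Y) [HasKernel f] : IsKernelOf (kernel.ι f) f :=
  ⟨kernel.condition f, ⟨kernelIsKernel f⟩⟩

lemma isCokernelOf_cokernelπ {X Y : C} (f : X ⟶ Y) [HasCokernel f] :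
    IsCokernelOf (cokernel.π f) f :=
  ⟨cokernel.condition f, ⟨cokernelIsCokernel f⟩⟩

namespace IsKernelOf

variable {K K' X Y Z : C} {i : K ⟶ X} {i' : K' ⟶ X} {f : X ⟶ Y}

lemma hasKernel (h : IsKernelOf i f) : HasKernel f :=
  let ⟨_, ⟨hl⟩⟩ := h
  ⟨⟨⟨_, hl⟩⟩⟩

lemma mono (h : IsKernelOf i f) : Mono i := by
  rw [isKernelOf_iff] at h
  refine ⟨fun a b hab => (h.2 (b ≫ i) (by rw [Category.assoc, h.1, comp_zero])).unique hab rfl⟩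

lemma exists_iso (h : IsKernelOf i f) (h' : IsKernelOf i' f) : ∃ e : K ≅ K', e.hom ≫ i' = i := by
  have := h.mono
  have := h'.mono
  rw [isKernelOf_iff] at h h'
  obtain ⟨a, ha, -⟩ := h'.2 i h.1
  obtain ⟨b, hb, -⟩ := h.2 i' h'.1
  exact ⟨⟨a, b, by rw [← cancel_mono i, Category.assoc, hb, ha, Category.id_comp],
    by rw [← cancel_mono i', Category.assoc, ha, hb, Category.id_comp]⟩, ha⟩

lemma iso_comp (h : IsKernelOf i f) (e : K' ⟶ K) [IsIso e] : IsKernelOf (e ≫ i) f := by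
  have := h.mono
  rw [isKernelOf_iff] at h ⊢
  refine ⟨by rw [Category.assoc, h.1, comp_zero], fun t ht => ?_⟩
  obtain ⟨l, hl, -⟩ := h.2 t ht
  refine ⟨l ≫ inv e, by simpa using hl, fun m hm => ?_⟩
  rw [IsIso.eq_comp_inv, ← cancel_mono i, hl, Category.assoc, hm]

lemma cokernelπ [HasCokernel i] (h : IsKernelOf i f) : IsKernelOf i (cokernel.π i) := by
  rw [isKernelOf_iff] at h ⊢
  refine ⟨cokernel.condition i, fun t ht => h.2 t ?_⟩
  rw [← cokernel.π_desc i f h.1, ← Category.assoc, ht, zero_comp]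

end IsKernelOf

namespace IsCokernelOf

variable {X Y Q Q' : C} {p : Y ⟶ Q} {p' : Y ⟶ Q'} {f : X ⟶ Y}

lemma hasCokernel (h : IsCokernelOf p f) : HasCokernel f :=
  let ⟨_, ⟨hl⟩⟩ := h
  ⟨⟨⟨_, hl⟩⟩⟩

lemma epi (h : IsCokernelOf p f) : Epi p := by
  rw [isCokernelOf_iff] at h
  refine ⟨fun a b hab => (h.2 (p ≫ b) (by rw [← Category.assoc, h.1, zero_comp])).unique hab rfl⟩

lemma exists_iso (h : IsCokernelOf p f) (h' : IsCokernelOf p' f) :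
    ∃ e : Q ≅ Q', p ≫ e.hom = p' := by
  have := h.epi
  have := h'.epi
  rw [isCokernelOf_iff] at h h'
  obtain ⟨a, ha, -⟩ := h.2 p' h'.1
  obtain ⟨b, hb, -⟩ := h'.2 p h.1
  exact ⟨⟨a, b, by rw [← cancel_epi p, ← Category.assoc, ha, hb, Category.comp_id],
    by rw [← cancel_epi p', ← Category.assoc, hb, ha, Category.comp_id]⟩, ha⟩

lemma comp_iso (h : IsCokernelOf p f) (e : Q ⟶ Q') [IsIso e] : IsCokernelOf (p ≫ e) f := by
  have := h.epi
  rw [isCokernelOf_iff] at h ⊢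
  refine ⟨by rw [← Category.assoc, h.1, zero_comp], fun t ht => ?_⟩
  obtain ⟨l, hl, -⟩ := h.2 t ht
  refine ⟨inv e ≫ l, by simpa using hl, fun m hm => ?_⟩
  rw [IsIso.eq_inv_comp, ← cancel_epi p, hl, ← Category.assoc, hm]

lemma kernelι [HasKernel p] (h : IsCokernelOf p f) : IsCokernelOf p (kernel.ι p) := by
  rw [isCokernelOf_iff] at h ⊢
  refine ⟨kernel.condition p, fun t ht => h.2 t ?_⟩
  rw [← kernel.lift_ι p f h.1, Category.assoc, ht, comp_zero]

end IsCokernelOf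

variable [HasKernels C] [HasCokernels C]

/-- The admissible monics are the kernels. -/
lemma mono_and_isAdmissible_iff {A B : C} (f : A ⟶ B) :
    Mono f ∧ IsAdmissible f ↔ ∃ (Z : C) (p : B ⟶ Z), IsKernelOf f p := by
  have hfac := Abelian.coimage_image_factorisation f
  have hπ : Mono f → IsIso (Abelian.coimage.π f) := by
    intro hf
    have h0 : kernel.ι f = 0 := by
      rw [← cancel_mono f, kernel.condition, zero_comp]
    have : Mono (Abelian.coimage.π f) := by
      rw [← hfac] at hf
      exact mono_of_mono _ (Abelian.coimageImageComparison f ≫ Abelian.image.ι f)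
    refine ⟨cokernel.desc _ (𝟙 A) (by rw [h0, zero_comp]), by simp, ?_⟩
    rw [← cancel_epi (Abelian.coimage.π f)]
    simp
  constructor
  · rintro ⟨hf, hadm⟩
    have := hπ hf
    have : IsIso (Abelian.coimageImageComparison f) := hadm
    refine ⟨_, cokernel.π f, ?_⟩
    have h := (isKernelOf_kernelι (cokernel.π f)).iso_comp
      (Abelian.coimage.π f ≫ Abelian.coimageImageComparison f)
    rwa [show (Abelian.coimage.π f ≫ Abelian.coimageImageComparison f) ≫ kernel.ι (cokernel.π f) = f
      by rw [Category.assoc]; exact hfac] at h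
  · rintro ⟨Z, p, h⟩
    refine ⟨h.mono, ?_⟩
    have := hπ h.mono
    -- A kernel is the kernel of its own cokernel, so `f` agrees with its image inclusion up to `e`;
    -- as the co-image projection is invertible, so is the comparison.
    obtain ⟨e, he⟩ := h.cokernelπ.exists_iso (isKernelOf_kernelι (cokernel.π f))
    have h1 : Abelian.coimage.π f ≫ Abelian.coimageImageComparison f = e.hom := by
      rw [← cancel_mono (kernel.ι (cokernel.π f)), he, Category.assoc]
      exact hfac
    have : IsIso (Abelian.coimage.π f ≫ Abelian.coimageImageComparison f) := h1 ▸ inferInstance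
    exact IsIso.of_isIso_comp_left (Abelian.coimage.π f) _

/-- The admissible epics are the cokernels. -/
lemma epi_and_isAdmissible_iff {A B : C} (f : A ⟶ B) :
    Epi f ∧ IsAdmissible f ↔ ∃ (Z : C) (i : Z ⟶ A), IsCokernelOf f i := by
  have hfac := Abelian.coimage_image_factorisation f
  have hι : Epi f → IsIso (Abelian.image.ι f) := by
    intro hf
    have h0 : cokernel.π f = 0 := by
      rw [← cancel_epi f, cokernel.condition, comp_zero]
    have : Epi (Abelian.image.ι f) := by
      rw [← hfac, ← Category.assoc] at hf
      exact epi_of_epi (Abelian.coimage.π f ≫ Abelian.coimageImageComparison f) _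
    refine ⟨kernel.lift _ (𝟙 B) (by rw [h0, comp_zero]), ?_, by simp⟩
    rw [← cancel_mono (Abelian.image.ι f)]
    simp
  constructor
  · rintro ⟨hf, hadm⟩
    have := hι hf
    have : IsIso (Abelian.coimageImageComparison f) := hadm
    refine ⟨_, kernel.ι f, ?_⟩
    have h := (isCokernelOf_cokernelπ (kernel.ι f)).comp_iso
      (Abelian.coimageImageComparison f ≫ Abelian.image.ι f)
    rwa [show cokernel.π (kernel.ι f) ≫ Abelian.coimageImageComparison f ≫ Abelian.image.ι f = f
      from hfac] at h
  · rintro ⟨Z, p, h⟩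
    refine ⟨h.epi, ?_⟩
    have := hι h.epi
    -- Dually, a cokernel is the cokernel of its own kernel, so `f` agrees with its co-image
    -- projection up to `e`.
    obtain ⟨e, he⟩ := (isCokernelOf_cokernelπ (kernel.ι f)).exists_iso h.kernelι
    have h1 : Abelian.coimageImageComparison f ≫ Abelian.image.ι f = e.hom := by
      rw [← cancel_epi (cokernel.π (kernel.ι f)), he]
      exact hfac
    have : IsIso (Abelian.coimageImageComparison f ≫ Abelian.image.ι f) := h1 ▸ inferInstance
    exact IsIso.of_isIso_comp_right _ (Abelian.image.ι f)

end Preadditive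

/-! ### Concrete constructions in `HA` -/

namespace HA

variable {X Y Z : HA.{u}}

lemma hom_ext {f g : X ⟶ Y} (h : ∀ x, f x = g x) : f = g :=
  ConcreteCategory.hom_ext _ _ h

lemma comp_eq_zero_iff {f : X ⟶ Y} {g : Y ⟶ Z} : f ≫ g = 0 ↔ ∀ x, g (f x) = 0 :=
  ⟨fun h x => congr($h x), fun h => hom_ext h⟩

lemma continuous_hom (f : X ⟶ Y) : Continuous f := f.toContHom.continuous_toFun

lemma closedRange_le_kerSubgroup {f : X ⟶ Y} {g : Y ⟶ Z} (h : f ≫ g = 0) :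
    closedRange f ≤ kerSubgroup g := by
  refine AddSubgroup.topologicalClosure_minimal _ ?_ (isClosed_kerSubgroup g)
  rintro _ ⟨x, rfl⟩
  exact comp_eq_zero_iff.1 h x

lemma closedRange_eq_top_iff (f : X ⟶ Y) : closedRange f = ⊤ ↔ DenseRange f := by
  rw [← SetLike.coe_set_eq, AddSubgroup.coe_top]
  exact dense_iff_closure_eq.symm

lemma mem_closedRange (f : X ⟶ Y) (x : X) : f x ∈ closedRange f :=
  AddSubgroup.le_topologicalClosure _ ⟨x, rfl⟩

/-- An isomorphism of Hausdorff abelian groups, as a homeomorphism. -/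
def homeomorphOfIso (e : X ≅ Y) : X ≃ₜ Y where
  toFun := e.hom
  invFun := e.inv
  left_inv x := congr($e.hom_inv_id x)
  right_inv x := congr($e.inv_hom_id x)
  continuous_toFun := continuous_hom e.hom
  continuous_invFun := continuous_hom e.inv

lemma isKernelOf_of_isEmbedding {i : X ⟶ Y} {g : Y ⟶ Z} (hi : IsEmbedding i)
    (hex : Function.Exact i g) : IsKernelOf i g := by
  refine isKernelOf_iff.2 ⟨comp_eq_zero_iff.2 hex.apply_apply_eq_zero, fun {W} t ht => ?_⟩
  choose l hl using fun w => (hex (t w)).1 (comp_eq_zero_iff.1 ht w)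
  refine ⟨⟨⟨AddMonoidHom.mk' l fun a b => hi.injective ?_, ?_⟩⟩, hom_ext hl,
    fun m hm => hom_ext fun w => hi.injective ?_⟩
  · rw [hl, map_add, map_add, hl, hl]
  · exact hi.continuous_iff.2 ((continuous_hom t).congr fun w => (hl w).symm)
  · exact (congr($hm w) : i (m w) = t w).trans (hl w).symm

/-- A morphism to a Hausdorff group that kills `f(X)` kills its closure, so it is constant on the
fibres of `p` and descends continuously along the quotient map. -/
lemma isCokernelOf_of_isQuotientMap {f : X ⟶ Y} {p : Y ⟶ Z} (hp : IsQuotientMap p)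
    (hex : ∀ y, p y = 0 ↔ y ∈ closedRange f) : IsCokernelOf p f := by
  refine isCokernelOf_iff.2 ⟨comp_eq_zero_iff.2 fun x => (hex _).2 (mem_closedRange f x),
    fun {W} t ht => ?_⟩
  obtain ⟨s, hs⟩ := hp.surjective.hasRightInverse
  have hker : ∀ y y', p y = p y' → t y = t y' := by
    intro y y' h
    rw [← sub_eq_zero, ← map_sub] at h ⊢
    exact closedRange_le_kerSubgroup ht ((hex _).1 h)
  have hst : ∀ y, t (s (p y)) = t y := fun y => hker _ _ (hs _)
  refine ⟨⟨⟨AddMonoidHom.mk' (fun z => t (s z)) fun a b => ?_, ?_⟩⟩, hom_ext hst,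
    fun m hm => hom_ext fun z => ?_⟩
  · rw [← map_add]
    exact hker _ _ (by rw [hs, map_add, hs, hs])
  · exact hp.continuous_iff.2 ((continuous_hom t).congr fun y => (hst y).symm)
  · have h : m (p (s z)) = t (s z) := congr($hm (s z))
    rw [hs] at h
    exact h

lemma isEmbedding_subι (A : AddSubgroup X) : IsEmbedding (X.subι A) := IsEmbedding.subtypeVal

lemma isClosedEmbedding_subι {A : AddSubgroup X} (hA : IsClosed (A : Set X)) :
    IsClosedEmbedding (X.subι A) := hA.isClosedEmbedding_subtypeVal

lemma isOpenQuotientMap_quotπ (A : AddSubgroup X) (hA : IsClosed (A : Set X)) :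
    IsOpenQuotientMap (X.quotπ A hA) := QuotientAddGroup.isOpenQuotientMap_mk

lemma quotπ_eq_zero_iff (A : AddSubgroup X) (hA : IsClosed (A : Set X)) (x : X) :
    X.quotπ A hA x = 0 ↔ x ∈ A := QuotientAddGroup.eq_zero_iff x

lemma isKernelOf_subι {A : AddSubgroup X} {g : X ⟶ Y} (h : ∀ x, g x = 0 ↔ x ∈ A) :
    IsKernelOf (X.subι A) g := by
  refine isKernelOf_of_isEmbedding (isEmbedding_subι A) fun x => (h x).trans ?_
  exact ⟨fun hx => ⟨⟨x, hx⟩, rfl⟩, by rintro ⟨a, rfl⟩; exact a.2⟩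

lemma isCokernelOf_quotπ {f : X ⟶ Y} {A : AddSubgroup Y} (hA : IsClosed (A : Set Y))
    (h : closedRange f = A) : IsCokernelOf (Y.quotπ A hA) f :=
  isCokernelOf_of_isQuotientMap (isOpenQuotientMap_quotπ A hA).isQuotientMap fun y => by
    rw [quotπ_eq_zero_iff, h]

lemma closedRange_subι {A : AddSubgroup X} (hA : IsClosed (A : Set X)) :
    closedRange (X.subι A) = A := by
  refine le_antisymm (AddSubgroup.topologicalClosure_minimal _ ?_ hA) fun x hx =>
    mem_closedRange (X.subι A) ⟨x, hx⟩
  rintro _ ⟨x, rfl⟩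
  exact x.2

/-! ### Products -/

/-- The product of two Hausdorff abelian groups. -/
def prod (X Y : HA.{u}) : HA.{u} where
  carrier := X × Y

/-- The projection to the first factor. -/
def prodFst (X Y : HA.{u}) : X.prod Y ⟶ X := ⟨ContinuousAddMonoidHom.fst X Y⟩

/-- The projection to the second factor. -/
def prodSnd (X Y : HA.{u}) : X.prod Y ⟶ Y := ⟨ContinuousAddMonoidHom.snd X Y⟩

/-- The inclusion of the first factor. -/
def prodInl (X Y : HA.{u}) : X ⟶ X.prod Y := ⟨ContinuousAddMonoidHom.inl X Y⟩

/-- The inclusion of the second factor. -/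
def prodInr (X Y : HA.{u}) : Y ⟶ X.prod Y := ⟨ContinuousAddMonoidHom.inr X Y⟩

lemma prod_total (X Y : HA.{u}) :
    prodFst X Y ≫ prodInl X Y + prodSnd X Y ≫ prodInr X Y = 𝟙 (X.prod Y) :=
  hom_ext fun p => Prod.ext (add_zero p.1) (zero_add p.2)

/-! ### Pushouts and pullbacks -/

variable {A B : HA.{u}}

/-- The closed subgroup `{(f a, -g a)}` by which `B × X` is divided to form a pushout. -/
def pushoutSubgroup (f : A ⟶ B) (g : A ⟶ X) : AddSubgroup (B.prod X) :=
  (f ≫ prodInl B X - g ≫ prodInr B X).toContHom.toAddMonoidHom.range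

lemma mem_pushoutSubgroup {f : A ⟶ B} {g : A ⟶ X} {p : B.prod X} :
    p ∈ pushoutSubgroup f g ↔ ∃ a, f a = p.1 ∧ -g a = p.2 := by
  refine exists_congr fun a => ?_
  refine (Prod.ext_iff (x := ((f a - 0, 0 - g a) : B × X))).trans ?_
  rw [sub_zero, zero_sub]

/-- The set is the image of the closed set `{(a, x) | x + g a ∈ S}` under the closed embedding `f ×
id`. With `S = {0}` it is the subgroup divided out; in general it is the preimage in `B × X` of the
image of `S` in the pushout. -/
lemma isClosed_pushout_saturation {f : A ⟶ B} (hf : IsClosedEmbedding f) (g : A ⟶ X) {S : Set X}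
    (hS : IsClosed S) : IsClosed {p : B × X | ∃ a, f a = p.1 ∧ p.2 + g a ∈ S} := by
  have h := (hf.prodMap IsClosedEmbedding.id).isClosedMap _
    (hS.preimage (continuous_snd.add ((continuous_hom g).comp continuous_fst)) :
      IsClosed {p : A × X | p.2 + g p.1 ∈ S})
  convert h using 1
  ext ⟨b, x⟩
  constructor
  · rintro ⟨a, h1, h2⟩
    exact ⟨(a, x), h2, Prod.ext h1 rfl⟩
  · rintro ⟨⟨a, x'⟩, h, heq⟩
    cases heq
    exact ⟨a, rfl, h⟩

lemma isClosed_pushoutSubgroup {f : A ⟶ B} (hf : IsClosedEmbedding f) (g : A ⟶ X) :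
    IsClosed (pushoutSubgroup f g : Set (B.prod X)) := by
  have h := isClosed_pushout_saturation hf g (isClosed_singleton (x := (0 : X)))
  refine (congrArg IsClosed (Set.ext fun p => ?_)).mpr h
  refine mem_pushoutSubgroup.trans (exists_congr fun a => and_congr_right fun _ => ?_)
  rw [Set.mem_singleton_iff, add_eq_zero_iff_eq_neg, eq_comm]

section Pushout

variable {f : A ⟶ B} (hf : IsClosedEmbedding f) (g : A ⟶ X)

/-- The pushout of a closed embedding. -/
def pushout : HA.{u} := (B.prod X).quot (pushoutSubgroup f g) (isClosed_pushoutSubgroup hf g)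

/-- The projection from the product to the pushout. -/
def pushoutπ : B.prod X ⟶ pushout hf g :=
  (B.prod X).quotπ (pushoutSubgroup f g) (isClosed_pushoutSubgroup hf g)

lemma isCokernelOf_pushoutπ :
    IsCokernelOf (pushoutπ hf g) (f ≫ prodInl B X - g ≫ prodInr B X) :=
  isCokernelOf_quotπ _ <| SetLike.coe_injective (isClosed_pushoutSubgroup hf g).closure_eq

lemma isOpenQuotientMap_pushoutπ : IsOpenQuotientMap (pushoutπ hf g) :=
  isOpenQuotientMap_quotπ _ _

lemma pushoutπ_eq_zero_iff (p : B.prod X) :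
    pushoutπ hf g p = 0 ↔ ∃ a, f a = p.1 ∧ -g a = p.2 :=
  (quotπ_eq_zero_iff _ _ p).trans mem_pushoutSubgroup

lemma isPushout_pushout :
    IsPushout f g (prodInl B X ≫ pushoutπ hf g) (prodInr B X ≫ pushoutπ hf g) := by
  obtain ⟨w, h⟩ := isCokernelOf_iff.1 (isCokernelOf_pushoutπ hf g)
  have hepi := (isCokernelOf_pushoutπ hf g).epi
  have hsq : f ≫ prodInl B X ≫ pushoutπ hf g = g ≫ prodInr B X ≫ pushoutπ hf g := by
    rw [Preadditive.sub_comp, sub_eq_zero] at w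
    simpa using w
  have hd : ∀ s : PushoutCocone f g, ∃ l : pushout hf g ⟶ s.pt,
      (prodInl B X ≫ pushoutπ hf g) ≫ l = s.inl ∧ (prodInr B X ≫ pushoutπ hf g) ≫ l = s.inr := by
    intro s
    obtain ⟨l, hl, -⟩ := h (prodFst B X ≫ s.inl + prodSnd B X ≫ s.inr) <| by
      refine comp_eq_zero_iff.2 fun a => ?_
      have hs : s.inl (f a) = s.inr (g a) := congr($s.condition a)
      change s.inl (f a - 0) + s.inr (0 - g a) = 0
      rw [sub_zero, zero_sub, map_neg, hs, add_neg_cancel]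
    refine ⟨l, ?_, ?_⟩
    · rw [Category.assoc, hl]
      refine hom_ext fun b => ?_
      change s.inl b + s.inr 0 = s.inl b
      rw [map_zero, add_zero]
    · rw [Category.assoc, hl]
      refine hom_ext fun x => ?_
      change s.inl 0 + s.inr x = s.inr x
      rw [map_zero, zero_add]
  choose l hl₁ hl₂ using hd
  refine ⟨⟨hsq⟩, ⟨PushoutCocone.IsColimit.mk hsq l hl₁ hl₂ fun s m hm₁ hm₂ => ?_⟩⟩
  -- By `prod_total`, a morphism out of the product is determined by its restrictions to the two
  -- factors.
  rw [← cancel_epi (pushoutπ hf g), ← Category.id_comp (pushoutπ hf g ≫ m),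
    ← Category.id_comp (pushoutπ hf g ≫ l s), ← prod_total]
  rw [← hl₁, Category.assoc, Category.assoc] at hm₁
  rw [← hl₂, Category.assoc, Category.assoc] at hm₂
  simp only [Preadditive.add_comp, Category.assoc, hm₁, hm₂]

lemma isClosedEmbedding_pushout : IsClosedEmbedding (prodInr B X ≫ pushoutπ hf g) := by
  refine .of_continuous_injective_isClosedMap (continuous_hom _) ?_ fun S hS => ?_
  · refine (injective_iff_map_eq_zero _).2 fun x hx => ?_
    obtain ⟨a, ha, hax⟩ := (pushoutπ_eq_zero_iff hf g _).1 hx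
    have ha0 : a = 0 := hf.injective (by rw [map_zero]; exact ha)
    rw [ha0, map_zero, neg_zero] at hax
    exact hax.symm
  · rw [← (isOpenQuotientMap_pushoutπ hf g).isQuotientMap.isClosed_preimage]
    refine (congrArg IsClosed (Set.ext fun p => ?_)).mpr (isClosed_pushout_saturation hf g hS)
    have key : ∀ x, (prodInr B X ≫ pushoutπ hf g) x = pushoutπ hf g p ↔
        ∃ a, f a = p.1 ∧ p.2 + g a = x := by
      intro x
      rw [eq_comm, ← sub_eq_zero]
      change pushoutπ hf g p - pushoutπ hf g (prodInr B X x) = 0 ↔ _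
      rw [← map_sub]
      refine (pushoutπ_eq_zero_iff hf g _).trans (exists_congr fun a => ?_)
      change f a = p.1 - 0 ∧ -g a = p.2 - x ↔ _
      rw [sub_zero]
      refine and_congr_right fun _ => ⟨fun h => ?_, fun h => ?_⟩
      · rw [← neg_neg (g a), h]; abel
      · rw [← h]; abel
    constructor
    · rintro ⟨x, hx, hxp⟩
      obtain ⟨a, ha, hax⟩ := (key x).1 hxp
      exact ⟨a, ha, by rwa [hax]⟩
    · rintro ⟨a, ha, hax⟩
      exact ⟨_, hax, (key _).2 ⟨a, ha, rfl⟩⟩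

end Pushout

section Pullback

variable (f : A ⟶ B) (g : Y ⟶ B)

/-- The closed subgroup `{(a, y) | f a = g y}` of `A × Y`. -/
def pullbackSubgroup : AddSubgroup (A.prod Y) :=
  kerSubgroup (prodFst A Y ≫ f - prodSnd A Y ≫ g)

variable {f g} in
lemma mem_pullbackSubgroup {p : A.prod Y} : p ∈ pullbackSubgroup f g ↔ f p.1 = g p.2 :=
  sub_eq_zero (a := f p.1) (b := g p.2)

lemma isClosed_pullbackSubgroup : IsClosed (pullbackSubgroup f g : Set (A.prod Y)) :=
  isClosed_kerSubgroup _

/-- The pullback of two morphisms. -/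
def pullback : HA.{u} := (A.prod Y).sub (pullbackSubgroup f g)

/-- The inclusion of the pullback into the product. -/
def pullbackι : pullback f g ⟶ A.prod Y := (A.prod Y).subι (pullbackSubgroup f g)

lemma isKernelOf_pullbackι :
    IsKernelOf (pullbackι f g) (prodFst A Y ≫ f - prodSnd A Y ≫ g) :=
  isKernelOf_subι fun _ => Iff.rfl

lemma isPullback_pullback :
    IsPullback (pullbackι f g ≫ prodFst A Y) (pullbackι f g ≫ prodSnd A Y) f g := by
  obtain ⟨w, h⟩ := isKernelOf_iff.1 (isKernelOf_pullbackι f g)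
  have hmono := (isKernelOf_pullbackι f g).mono
  have hsq : (pullbackι f g ≫ prodFst A Y) ≫ f = (pullbackι f g ≫ prodSnd A Y) ≫ g := by
    rw [Preadditive.comp_sub, sub_eq_zero] at w
    simpa using w
  have hd : ∀ s : PullbackCone f g, ∃ l : s.pt ⟶ pullback f g,
      l ≫ (pullbackι f g ≫ prodFst A Y) = s.fst ∧ l ≫ (pullbackι f g ≫ prodSnd A Y) = s.snd := by
    intro s
    obtain ⟨l, hl, -⟩ := h (s.fst ≫ prodInl A Y + s.snd ≫ prodInr A Y) <| by
      refine comp_eq_zero_iff.2 fun a => ?_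
      have hs : f (s.fst a) = g (s.snd a) := congr($s.condition a)
      change f (s.fst a + 0) - g (0 + s.snd a) = 0
      rw [add_zero, zero_add, hs, sub_self]
    refine ⟨l, ?_, ?_⟩
    · rw [← Category.assoc, hl]
      exact hom_ext fun b => add_zero (s.fst b)
    · rw [← Category.assoc, hl]
      exact hom_ext fun b => zero_add (s.snd b)
  choose l hl₁ hl₂ using hd
  refine ⟨⟨hsq⟩, ⟨PullbackCone.IsLimit.mk hsq l hl₁ hl₂ fun s m hm₁ hm₂ => ?_⟩⟩
  rw [← cancel_mono (pullbackι f g), ← Category.comp_id (m ≫ pullbackι f g),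
    ← Category.comp_id (l s ≫ pullbackι f g), ← prod_total]
  rw [← hl₁] at hm₁
  rw [← hl₂] at hm₂
  simp only [Preadditive.comp_add, ← Category.assoc] at hm₁ hm₂ ⊢
  rw [hm₁, hm₂]

lemma isOpenQuotientMap_pullback (hf : IsOpenQuotientMap f) :
    IsOpenQuotientMap (pullbackι f g ≫ prodSnd A Y) := by
  refine ⟨fun y => ?_, continuous_hom _, IsOpenMap.of_nhds_le ?_⟩
  · obtain ⟨a, ha⟩ := hf.surjective (g y)
    exact ⟨⟨(a, y), mem_pullbackSubgroup.2 ha⟩, rfl⟩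
  · rintro ⟨⟨a, y⟩, hay⟩ S hS
    rw [Filter.mem_map] at hS
    obtain ⟨T, hT, hTS⟩ := mem_nhds_subtype _ _ _ |>.1 hS
    obtain ⟨U, hU, V, hV, hUV⟩ := mem_nhds_prod_iff.1 hT
    -- Openness of `f` makes `V ∩ g ⁻¹' (f '' U)` a neighbourhood of `y`, and each of its points
    -- lifts to a point of the pullback with first coordinate in `U`.
    have hgy : g ⁻¹' (f '' U) ∈ 𝓝 y := (continuous_hom g).continuousAt <| by
      rw [← mem_pullbackSubgroup.1 hay]
      exact hf.isOpenMap.image_mem_nhds hU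
    refine Filter.mem_of_superset (Filter.inter_mem hV hgy) ?_
    rintro y' ⟨hy', a', ha', h⟩
    exact hTS (a := ⟨(a', y'), mem_pullbackSubgroup.2 h⟩) (hUV ⟨ha', hy'⟩)

end Pullback

end HA

/-! ### Subcategories stable under closed subgroups, quotients and products -/

/-- A full subcategory of `HA` stable under closed subgroups, quotients by closed subgroups and
finite products. -/
structure IsStableSubcategory (P : ObjectProperty HA.{u}) : Prop where
  sub : ∀ (X : HA.{u}) (A : AddSubgroup X), IsClosed (A : Set X) → P X → P (X.sub A)
  quot : ∀ (X : HA.{u}) (A : AddSubgroup X) (hA : IsClosed (A : Set X)), P X → P (X.quot A hA)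
  prod : ∀ X Y : HA.{u}, P X → P Y → P (X.prod Y)
  exists_subsingleton : ∃ X : HA.{u}, P X ∧ Subsingleton X

namespace HA

variable {P : ObjectProperty HA.{u}} {X Y Z : P.FullSubcategory}

lemma isKernelOf_of_hom {i : X ⟶ Y} {f : Y ⟶ Z} (h : IsKernelOf i.hom f.hom) :
    IsKernelOf i f := by
  rw [isKernelOf_iff] at h ⊢
  refine ⟨ObjectProperty.hom_ext _ h.1, fun t ht => ?_⟩
  obtain ⟨l, hl, hu⟩ := h.2 t.hom congr(($ht).hom)
  exact ⟨ObjectProperty.homMk l, ObjectProperty.hom_ext _ hl,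
    fun m hm => ObjectProperty.hom_ext _ (hu m.hom congr(($hm).hom))⟩

lemma isCokernelOf_of_hom {f : X ⟶ Y} {p : Y ⟶ Z} (h : IsCokernelOf p.hom f.hom) :
    IsCokernelOf p f := by
  rw [isCokernelOf_iff] at h ⊢
  refine ⟨ObjectProperty.hom_ext _ h.1, fun t ht => ?_⟩
  obtain ⟨l, hl, hu⟩ := h.2 t.hom congr(($ht).hom)
  exact ⟨ObjectProperty.homMk l, ObjectProperty.hom_ext _ hl,
    fun m hm => ObjectProperty.hom_ext _ (hu m.hom congr(($hm).hom))⟩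

lemma isZero_iff_subsingleton : IsZero X ↔ Subsingleton X.obj := by
  rw [IsZero.iff_id_eq_zero]
  constructor
  · intro h
    exact subsingleton_of_forall_eq 0 fun x => congr(($h).hom x)
  · intro h
    exact ObjectProperty.hom_ext _ (hom_ext fun x => Subsingleton.elim _ _)

end HA

namespace IsStableSubcategory

open HA

variable {P : ObjectProperty HA.{u}} (hP : IsStableSubcategory P) {X Y Z : P.FullSubcategory}

include hP

lemma prop_ker (f : X ⟶ Y) : P (ker f.hom) := hP.sub _ _ (isClosed_kerSubgroup _) X.property

lemma prop_im (f : X ⟶ Y) : P (im f.hom) := hP.sub _ _ (isClosed_closedRange _) Y.property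

lemma prop_coker (f : X ⟶ Y) : P (coker f.hom) := hP.quot _ _ _ Y.property

lemma prop_coim (f : X ⟶ Y) : P (coim f.hom) := hP.quot _ _ _ X.property

lemma isKernelOf_kerι (f : X ⟶ Y) : IsKernelOf
    (ObjectProperty.homMk (kerι f.hom) : (⟨ker f.hom, hP.prop_ker f⟩ : P.FullSubcategory) ⟶ X) f :=
  isKernelOf_of_hom (isKernelOf_subι fun _ => Iff.rfl)

lemma isCokernelOf_cokerπ (f : X ⟶ Y) : IsCokernelOf
    (ObjectProperty.homMk (cokerπ f.hom) :
      Y ⟶ (⟨coker f.hom, hP.prop_coker f⟩ : P.FullSubcategory)) f :=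
  isCokernelOf_of_hom (isCokernelOf_quotπ _ rfl)

lemma mono_iff_subsingleton_ker (f : X ⟶ Y) : Mono f ↔ Subsingleton (ker f.hom) := by
  obtain ⟨w, h⟩ := isKernelOf_iff.1 (hP.isKernelOf_kerι f)
  constructor
  · intro hf
    have h0 := zero_of_comp_mono f w
    exact subsingleton_of_forall_eq 0 fun x => Subtype.ext (congr(($h0).hom x) :)
  · refine fun hs => Preadditive.mono_of_cancel_zero f fun t ht => ?_
    obtain ⟨l, rfl, -⟩ := h t ht
    have hl : l = 0 := (isZero_iff_subsingleton.2 hs).eq_of_tgt _ _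
    rw [hl, zero_comp]

lemma mono_iff_injective (f : X ⟶ Y) : Mono f ↔ Function.Injective f.hom := by
  rw [hP.mono_iff_subsingleton_ker, injective_iff_map_eq_zero]
  constructor
  · intro h x hx
    exact congrArg Subtype.val (h.elim (⟨x, hx⟩ : kerSubgroup f.hom) 0)
  · intro h
    exact subsingleton_of_forall_eq 0 fun x => Subtype.ext (h x.1 x.2)

lemma epi_iff_subsingleton_coker (f : X ⟶ Y) : Epi f ↔ Subsingleton (coker f.hom) := by
  obtain ⟨w, h⟩ := isCokernelOf_iff.1 (hP.isCokernelOf_cokerπ f)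
  constructor
  · intro hf
    have h0 := zero_of_epi_comp f w
    refine subsingleton_of_forall_eq 0 fun y => ?_
    obtain ⟨y, rfl⟩ :=
      (isOpenQuotientMap_quotπ (closedRange f.hom) (isClosed_closedRange _)).surjective y
    exact (congr(($h0).hom y) :)
  · refine fun hs => Preadditive.epi_of_cancel_zero f fun t ht => ?_
    obtain ⟨l, rfl, -⟩ := h t ht
    have hl : l = 0 := (isZero_iff_subsingleton.2 hs).eq_of_src _ _
    rw [hl, comp_zero]

lemma epi_iff_denseRange (f : X ⟶ Y) : Epi f ↔ DenseRange f.hom := by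
  rw [hP.epi_iff_subsingleton_coker, ← closedRange_eq_top_iff]
  constructor
  · intro h
    exact eq_top_iff.2 fun y _ =>
      (quotπ_eq_zero_iff _ (isClosed_closedRange f.hom) y).1 (h.elim _ _)
  · intro h
    refine subsingleton_of_forall_eq 0 fun y => ?_
    obtain ⟨y, rfl⟩ :=
      (isOpenQuotientMap_quotπ (closedRange f.hom) (isClosed_closedRange _)).surjective y
    exact (quotπ_eq_zero_iff _ _ y).2 (h ▸ AddSubgroup.mem_top y)

lemma computedAsInHA (f : X ⟶ Y) : ComputedAsInHA P f where
  ker_mem := hP.prop_ker f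
  ker_isKernel := hP.isKernelOf_kerι f
  ker_isKernel_HA := isKernelOf_subι fun _ => Iff.rfl
  kerι_injective := Subtype.val_injective
  kerι_isClosedMap := (isClosedEmbedding_subι (isClosed_kerSubgroup f.hom)).isClosedMap
  coker_mem := hP.prop_coker f
  coker_isCokernel := hP.isCokernelOf_cokerπ f
  coker_isCokernel_HA := isCokernelOf_quotπ _ rfl
  cokerπ_surjective := (isOpenQuotientMap_quotπ _ (isClosed_closedRange f.hom)).surjective
  cokerπ_isOpenMap := (isOpenQuotientMap_quotπ _ (isClosed_closedRange f.hom)).isOpenMap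
  mono_iff_injective := hP.mono_iff_injective f
  mono_iff_ker_isZero := (hP.mono_iff_subsingleton_ker f).trans
    (isZero_iff_subsingleton (X := ⟨ker f.hom, hP.prop_ker f⟩)).symm
  im_mem := hP.prop_im f
  im_isKernel := isKernelOf_of_hom (isKernelOf_subι fun y => quotπ_eq_zero_iff _ _ y)
  epi_iff_denseRange := hP.epi_iff_denseRange f
  epi_iff_coker_isZero := (hP.epi_iff_subsingleton_coker f).trans
    (isZero_iff_subsingleton (X := ⟨coker f.hom, hP.prop_coker f⟩)).symm
  coim_mem := hP.prop_coim f
  coim_isCokernel :=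
    isCokernelOf_of_hom (isCokernelOf_quotπ _ (closedRange_subι (isClosed_kerSubgroup f.hom)))

lemma hasKernels : HasKernels P.FullSubcategory :=
  ⟨fun f => (hP.isKernelOf_kerι f).hasKernel⟩

lemma hasCokernels : HasCokernels P.FullSubcategory :=
  ⟨fun f => (hP.isCokernelOf_cokerπ f).hasCokernel⟩

lemma hasFiniteBiproducts : HasFiniteBiproducts P.FullSubcategory := by
  have : HasZeroObject P.FullSubcategory := by
    obtain ⟨X, hX, hs⟩ := hP.exists_subsingleton
    exact ⟨⟨X, hX⟩, isZero_iff_subsingleton.2 hs⟩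
  have : HasBinaryBiproducts P.FullSubcategory := ⟨fun X Y =>
    hasBinaryBiproduct_of_total
      { pt := ⟨X.obj.prod Y.obj, hP.prod _ _ X.property Y.property⟩
        fst := ObjectProperty.homMk (prodFst X.obj Y.obj)
        snd := ObjectProperty.homMk (prodSnd X.obj Y.obj)
        inl := ObjectProperty.homMk (prodInl X.obj Y.obj)
        inr := ObjectProperty.homMk (prodInr X.obj Y.obj) }
      (ObjectProperty.hom_ext _ (prod_total X.obj Y.obj))⟩
  have := hasFiniteProducts_of_has_binary_and_terminal (C := P.FullSubcategory)
  exact HasFiniteBiproducts.of_hasFiniteProducts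

/-- A closed embedding has closed range, hence is a kernel of the projection to its concrete
cokernel. Conversely, uniqueness of kernels identifies any kernel with the inclusion of a closed
subgroup, and isomorphisms are homeomorphisms. -/
lemma isClosedEmbedding_iff (f : X ⟶ Y) :
    IsClosedEmbedding f.hom ↔ ∃ (Z : P.FullSubcategory) (p : Y ⟶ Z), IsKernelOf f p := by
  constructor
  · refine fun hf => ⟨_, _, isKernelOf_of_hom (Z := ⟨coker f.hom, hP.prop_coker f⟩)
      (f := ObjectProperty.homMk (cokerπ f.hom)) (isKernelOf_of_isEmbedding hf.isEmbedding ?_)⟩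
    have hr : (closedRange f.hom : Set Y.obj) = Set.range f.hom := hf.isClosed_range.closure_eq
    intro y
    rw [← hr]
    exact quotπ_eq_zero_iff _ _ y
  · rintro ⟨Z, p, h⟩
    obtain ⟨e, rfl⟩ := h.exists_iso (hP.isKernelOf_kerι p)
    exact (isClosedEmbedding_subι (isClosed_kerSubgroup p.hom)).comp
      (homeomorphOfIso (P.ι.mapIso e)).isClosedEmbedding

/-- An open quotient map is a cokernel of its concrete kernel, which is closed. Conversely, any
cokernel is a quotient projection followed by a homeomorphism. -/
lemma isOpenQuotientMap_iff (f : X ⟶ Y) :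
    IsOpenQuotientMap f.hom ↔ ∃ (Z : P.FullSubcategory) (i : Z ⟶ X), IsCokernelOf f i := by
  constructor
  · refine fun hf => ⟨_, _, isCokernelOf_of_hom (X := ⟨ker f.hom, hP.prop_ker f⟩)
      (f := ObjectProperty.homMk (kerι f.hom))
      (isCokernelOf_of_isQuotientMap hf.isQuotientMap fun y => ?_)⟩
    exact (closedRange_subι (isClosed_kerSubgroup f.hom)).symm ▸ Iff.rfl
  · rintro ⟨Z, p, h⟩
    obtain ⟨e, rfl⟩ := (hP.isCokernelOf_cokerπ p).exists_iso h
    exact (homeomorphOfIso (P.ι.mapIso e)).isOpenQuotientMap.comp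
      (isOpenQuotientMap_quotπ _ (isClosed_closedRange p.hom))

lemma exists_isPushout (f : X ⟶ Y) (g : X ⟶ Z) (hf : IsClosedEmbedding f.hom) :
    ∃ (Q : P.FullSubcategory) (g' : Y ⟶ Q) (f' : Z ⟶ Q),
      IsPushout f g g' f' ∧ IsClosedEmbedding f'.hom := by
  refine ⟨⟨pushout hf g.hom, hP.quot _ _ _ (hP.prod _ _ Y.property Z.property)⟩,
    ObjectProperty.homMk (prodInl _ _ ≫ pushoutπ hf g.hom),
    ObjectProperty.homMk (prodInr _ _ ≫ pushoutπ hf g.hom), ?_, isClosedEmbedding_pushout hf g.hom⟩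
  -- The square is a pushout in `HA` and all its objects satisfy `P`; the fully faithful inclusion
  -- reflects this.
  have : ReflectsColimitsOfSize.{0, 0} P.ι := fullyFaithful_reflectsColimits P.ι
  have : ReflectsColimitsOfShape WalkingSpan P.ι := ReflectsColimitsOfSize.reflectsColimitsOfShape
  have : ReflectsColimit (span f g) P.ι := ReflectsColimitsOfShape.reflectsColimit
  exact IsPushout.of_map P.ι (ObjectProperty.hom_ext _ (isPushout_pushout hf g.hom).w)
    (isPushout_pushout hf g.hom)

lemma exists_isPullback (f : X ⟶ Y) (g : Z ⟶ Y) (hf : IsOpenQuotientMap f.hom) :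
    ∃ (Q : P.FullSubcategory) (g' : Q ⟶ X) (f' : Q ⟶ Z),
      IsPullback g' f' f g ∧ IsOpenQuotientMap f'.hom := by
  refine ⟨⟨pullback f.hom g.hom,
      hP.sub _ _ (isClosed_pullbackSubgroup _ _) (hP.prod _ _ X.property Z.property)⟩,
    ObjectProperty.homMk (pullbackι _ _ ≫ prodFst _ _),
    ObjectProperty.homMk (pullbackι _ _ ≫ prodSnd _ _), ?_, isOpenQuotientMap_pullback f.hom g.hom hf⟩
  have : ReflectsLimitsOfSize.{0, 0} P.ι := fullyFaithful_reflectsLimits P.ι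
  have : ReflectsLimitsOfShape WalkingCospan P.ι := ReflectsLimitsOfSize.reflectsLimitsOfShape
  have : ReflectsLimit (cospan f g) P.ι := ReflectsLimitsOfShape.reflectsLimit
  exact IsPullback.of_map P.ι (ObjectProperty.hom_ext _ (isPullback_pullback f.hom g.hom).w)
    (isPullback_pullback f.hom g.hom)

/-- Through the dictionary with closed embeddings and open quotient maps, both preservation axioms
become topological. An arbitrary pushout or pullback differs from the constructed one by a
homeomorphism, which affects neither class. -/
theorem isQuasiAbelian : IsQuasiAbelian P.FullSubcategory := by
  have := hP.hasFiniteBiproducts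
  have := hP.hasKernels
  have := hP.hasCokernels
  have hmono : ∀ {X Y : P.FullSubcategory} (f : X ⟶ Y),
      Mono f ∧ IsAdmissible f ↔ IsClosedEmbedding f.hom := fun f =>
    (mono_and_isAdmissible_iff f).trans (hP.isClosedEmbedding_iff f).symm
  have hepi : ∀ {X Y : P.FullSubcategory} (f : X ⟶ Y),
      Epi f ∧ IsAdmissible f ↔ IsOpenQuotientMap f.hom := fun f =>
    (epi_and_isAdmissible_iff f).trans (hP.isOpenQuotientMap_iff f).symm
  refine ⟨?_, ?_, ?_, ?_⟩
  · intro A B X f g hf hadm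
    obtain ⟨Q, g', f', h, -⟩ := hP.exists_isPushout f g ((hmono f).1 ⟨hf, hadm⟩)
    exact h.hasPushout
  · intro A B X Q f g g' f' h hf hadm
    obtain ⟨Q₀, g₀, f₀, h₀, hf₀⟩ := hP.exists_isPushout f g ((hmono f).1 ⟨hf, hadm⟩)
    rw [hmono, ← h₀.inr_isoIsPushout_hom _ _ h]
    exact (homeomorphOfIso (P.ι.mapIso (h₀.isoIsPushout _ _ h))).isClosedEmbedding.comp hf₀
  · intro A B X f g hf hadm
    obtain ⟨Q, g', f', h, -⟩ := hP.exists_isPullback f g ((hepi f).1 ⟨hf, hadm⟩)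
    exact h.hasPullback
  · intro A B X Q f g g' f' h hf hadm
    obtain ⟨Q₀, g₀, f₀, h₀, hf₀⟩ := hP.exists_isPullback f g ((hepi f).1 ⟨hf, hadm⟩)
    rw [hepi, ← h.isoIsPullback_hom_snd _ _ h₀]
    exact hf₀.comp (homeomorphOfIso (P.ι.mapIso (h.isoIsPullback _ _ h₀))).isOpenQuotientMap

end IsStableSubcategory

/-! ### Application to `LPA` and `PGA` -/

lemma isPrecompactlyGenerated_of_subsingleton (G : Type u) [AddCommGroup G] [TopologicalSpace G]
    [Subsingleton G] : IsPrecompactlyGenerated G :=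
  ⟨Set.univ, Filter.univ_mem, .of_finite (Set.toFinite _), AddSubgroup.closure_univ⟩

lemma PGA_iff (X : HA.{u}) : PGA X ↔ IsPrecompactlyGenerated X :=
  ⟨And.right, fun h => ⟨h.isLocallyPrecompact, h⟩⟩

/-- The trivial group. -/
def HA.trivial : HA.{u} where
  carrier := PUnit

lemma LPA.isStableSubcategory : IsStableSubcategory LPA.{u} where
  sub _ A _ hX := IsLocallyPrecompact.of_isInducing hX A.subtype .subtypeVal
  quot _ A _ hX := IsLocallyPrecompact.of_isOpenMap hX (QuotientAddGroup.mk' A)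
    QuotientAddGroup.continuous_mk QuotientAddGroup.isOpenMap_coe
  prod _ _ hX hY := IsLocallyPrecompact.prod hX hY
  exists_subsingleton := ⟨.trivial,
    (isPrecompactlyGenerated_of_subsingleton PUnit).isLocallyPrecompact,
    inferInstanceAs (Subsingleton PUnit)⟩

lemma PGA.isStableSubcategory : IsStableSubcategory PGA.{u} where
  sub _ A _ hX := (PGA_iff _).2 (hX.2.addSubgroup A)
  quot _ A _ hX := (PGA_iff _).2 (hX.2.of_isOpenMap (QuotientAddGroup.mk' A)
    QuotientAddGroup.continuous_mk QuotientAddGroup.isOpenMap_coe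
    (QuotientAddGroup.mk'_surjective A))
  prod _ _ hX hY := (PGA_iff _).2 (hX.2.prod hY.2)
  exists_subsingleton := ⟨.trivial, (PGA_iff _).2 (isPrecompactlyGenerated_of_subsingleton PUnit),
    inferInstanceAs (Subsingleton PUnit)⟩

theorem mainTheorem8 :
    -- closed subgroups and quotients of locally precompact groups
    (∀ (X : HA.{u}) (A : AddSubgroup X) (hA : IsClosed (A : Set X)),
      LPA X → LPA (X.sub A) ∧ LPA (X.quot A hA)) ∧
    -- closed subgroups and quotients of locally precompact, precompactly generated groups
    (∀ (X : HA.{u}) (A : AddSubgroup X) (hA : IsClosed (A : Set X)),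
      PGA X → PGA (X.sub A) ∧ PGA (X.quot A hA)) ∧
    -- extension-closedness
    (∀ (X' X X'' : LPA.{u}.FullSubcategory) (i : X' ⟶ X) (j : X ⟶ X''),
      HA.IsExactSequence i.hom j.hom → PGA X'.obj → PGA X''.obj → PGA X.obj) ∧
    -- kernels, cokernels, images, co-images, monics and epics
    (∀ (X Y : LPA.{u}.FullSubcategory) (f : X ⟶ Y), ComputedAsInHA LPA f) ∧
    (∀ (X Y : PGA.{u}.FullSubcategory) (f : X ⟶ Y), ComputedAsInHA PGA f) ∧
    IsQuasiAbelian LPA.{u}.FullSubcategory ∧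
    IsQuasiAbelian PGA.{u}.FullSubcategory := by
  have hL := LPA.isStableSubcategory.{u}
  have hP := PGA.isStableSubcategory.{u}
  refine ⟨fun X A hA hX => ⟨hL.sub X A hA hX, hL.quot X A hA hX⟩,
    fun X A hA hX => ⟨hP.sub X A hA hX, hP.quot X A hA hX⟩, fun X' X X'' i j h hX' hX'' => ?_,
    fun X Y f => hL.computedAsInHA f, fun X Y f => hP.computedAsInHA f,
    hL.isQuasiAbelian, hP.isQuasiAbelian⟩
  exact (PGA_iff _).2 <| hX'.2.of_extension X.property hX''.2 i.hom.toContHom.toAddMonoidHom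
    (HA.continuous_hom i.hom) j.hom.toContHom.toAddMonoidHom h.isOpenMap h.surjective h.exact
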